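/- **Setting.** Let $T$ be a locally compact Hausdorff space. A *continuous Hilbert bundle* $(T,\{H_t\}_{t\in T},\Omega)$ consists of Hilbert spaces $H_t$ and a vector space $\Omega$ of vector fields $\omega=(\omega(t)\in H_t)_{t\in T}$ such that (I) $\Omega$ is a $C(T)$-module under pointwise multiplication; (II) $\{\omega(t):\omega\in\Omega\}=H_t$ for every $t$; (III) $t\mapsto\|\omega(t)\|$ is continuous for every $\omega\in\Omega$; (IV) every vector field that is a local uniform limit of elements of $\Omega$ belongs to $\Omega$. Here $\xi$ is a *local uniform limit* of a set $\mathcal E$ of vector fields if for all $t_0$ and $\varepsilon>0$ there are an open $U\ni t_0$ and $\omega\in\mathcal E$ with $\|\omega(t)-\xi(t)\|<\varepsilon$ for all $t\in U$. Inner products are linear in the first variable, and $\Omega_b$ is the space of bounded elements of $\Omega$. For a topological space $S$, Hilbert spaces $\{H_s\}_{s\in S}$ and a vector space $\Omega$ of vector fields on $S$, the *Fell algebra* $A(S,\{H_s\},\Omega)$ is the set of operator fields $a=(a(s)\in B(H_s))_s$ such that: $s\mapsto\langle a(s)\omega_1(s),\omega_2(s)\rangle$ is continuous for all $\omega_1,\omega_2\in\Omega$;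 $a$ is almost finite-dimensional, that is, for all $s_0$ and $\varepsilon>0$ there are an open $U\ni s_0$, an $n\ge 0$ and $\omega_1,\dots,\omega_n\in\Omega$ such that for every $s\in U$ the vectors $\omega_1(s),\dots,\omega_n(s)$ are linearly independent and $\|p_sa(s)p_s-a(s)\|<\varepsilon$, where $p_s$ is the orthogonal projection onto their span; and $s\mapsto\|a(s)\|$ is continuous and vanishes at infinity. It carries the pointwise operations and the supremum norm. **The direct limit bundle.** Let $(T,\{H_t\},\Omega)$ be a continuous Hilbert bundle and $A=A(T,\{H_t\},\Omega)$. Let $\mathcal I$ be the set of essential ideals of $A$, i.e. the closed two-sided ideals $I$ that have nonzero intersection with every nonzero closed two-sided ideal, directed by $J\preccurlyeq I\iff I\subseteq J$. For $I\in\mathcal I$ put $X^I=\{t\in T: b(t)\neq0\text{ for some }b\in I\}$. For $t$ in the Stone–Čech compactification $\beta X^I$, let $\langle\omega,\nu\rangle^I_t$ be the value at $t$ of the continuous extension to $\beta X^I$ of the function $x\mapsto\langle\omega(x),\nu(x)\rangle$ on $X^I$, for $\omega,\nu\in\Omega_b$. Let $H^I_t$ be the completion of $\Omega_b$ modulo the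 null space of this form and $\overline\omega^I(t)\in H_t^I$ the class of $\omega$. Let $\Omega^I$ be the set of vector fields on $\beta X^I$ that are local uniform limits of the fields $\overline\omega^I$, $\omega\in\Omega_b$, and let $A^I=A(\beta X^I,\{H^I_t\},\Omega^I)$. For $J\preccurlyeq I$ let $\Phi_{JI}:\beta X^I\to\beta X^J$ be the continuous extension of the inclusion $X^I\subseteq X^J$, and let $\Psi_{JIt}:H^J_{\Phi_{JI}(t)}\to H^I_t$ be the unitary with $\overline\omega^J(\Phi_{JI}(t))\mapsto\overline\omega^I(t)$. Let $\Delta=\varprojlim\beta X^I$ with projections $\Phi_I:\Delta\to\beta X^I$. For $s\in\Delta$ let $H_s=\varinjlim H^I_{\Phi_I(s)}$ be the Hilbert space direct limit of these unitaries, with canonical unitaries $\Psi_{I,s}:H^I_{\Phi_I(s)}\to H_s$. For $\nu\in\Omega^I$ and $a\in A^I$ define fields on $\Delta$ by $(\nu\circ\Phi_I)(s)=\Psi_{I,s}\,\nu(\Phi_I(s))$ and $(a\circ\Phi_I)(s)=\Psi_{I,s}\,a(\Phi_I(s))\,\Psi_{I,s}^{-1}$. Let $\Omega^\Delta$ be the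 set of bounded vector fields on $\Delta$ that are local uniform limits of $\{\nu\circ\Phi_I: I\in\mathcal I,\ \nu\in\Omega^I\}$; it is a Hilbert $C(\Delta)$-module with $\langle\xi,\eta\rangle(s)=\langle\xi(s),\eta(s)\rangle$ and the supremum norm. Let $B(\Omega^\Delta)$ be the C$^*$-algebra of its bounded adjointable endomorphisms, and $K(\Omega^\Delta)$ the norm closure in $B(\Omega^\Delta)$ of the set of finite sums of the maps $\Theta_{\omega,\nu}\,\xi=\langle\xi,\nu\rangle\cdot\omega$ with $\omega,\nu\in\Omega^\Delta$. Finally put $$A_\Delta=\overline{\bigcup_{I\in\mathcal I}\{a\circ\Phi_I:a\in A^I\}}^{\,\|\cdot\|},\qquad A^\Delta=A(\Delta,\{H_s\}_{s\in\Delta},\Omega^\Delta),$$ where the closure is taken in the algebra of bounded operator fields on $\Delta$ with the supremum norm. **Proposition 4.2.** $K(\Omega^\Delta)=A_\Delta=A^\Delta$. Here $A_\Delta=A^\Delta$ is an equality of sets of operator fields on $\Delta$, and $K(\Omega^\Delta)=A_\Delta$ is understood through the identification of adjointable endomorphisms with operator fields acting pointwise: there is an isometric $*$-homomorphism $\Gamma$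 from $B(\Omega^\Delta)$ into the algebra of bounded operator fields on $\Delta$ such that $(k\xi)(s)=\Gamma(k)(s)\,\xi(s)$ for all $k\in B(\Omega^\Delta)$, $\xi\in\Omega^\Delta$, $s\in\Delta$, and $\Gamma(K(\Omega^\Delta))=A_\Delta$. -/

import Mathlib

open Topology Filter
open scoped ENNReal BoundedContinuousFunction

noncomputable section

/-! ## Hilbert direct limits -/

/-- A direct system of Hilbert spaces and linear isometries over a directed set. -/
structure HilbertSystem (ι : Type*) [SemilatticeSup ι] (G : ι → Type*)
    [∀ i, NormedAddCommGroup (G i)] [∀ i, InnerProductSpace ℂ (G i)] where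
  map : ∀ i j : ι, i ≤ j → G i →ₗᵢ[ℂ] G j
  map_map : ∀ (i j k : ι) (hij : i ≤ j) (hjk : j ≤ k) (x : G i),
    map j k hjk (map i j hij x) = map i k (hij.trans hjk) x

namespace HilbertSystem

variable {ι : Type*} [SemilatticeSup ι] {G : ι → Type*}
  [∀ i, NormedAddCommGroup (G i)] [∀ i, InnerProductSpace ℂ (G i)]

/-- Finitely supported families `(v_i)`, viewed as representatives of vectors of the algebraic
direct limit: `v` represents the sum of the classes of the `v i`. -/
def Pre (_S : HilbertSystem ι G) : Type _ := Π₀ i, G i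

variable (S : HilbertSystem ι G)

instance : AddCommGroup S.Pre := inferInstanceAs (AddCommGroup (Π₀ i, G i))
instance : Module ℂ S.Pre := inferInstanceAs (Module ℂ (Π₀ i, G i))

open Classical in
/-- The semi-inner product on representatives: two vectors at the stages `i` and `j` are paired
after they have been pushed to the common later stage `i ⊔ j`. -/
def form (v w : Π₀ i, G i) : ℂ :=
  ∑ i ∈ v.support, ∑ j ∈ w.support,
    inner ℂ (S.map i (i ⊔ j) le_sup_left (v i)) (S.map j (i ⊔ j) le_sup_right (w j))

open Classical in
/-- Push everything that lives at a stage `≤ k` to the stage `k`. -/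
def push (k : ι) : (Π₀ i, G i) →ₗ[ℂ] G k :=
  DFinsupp.lsum ℂ fun i => if h : i ≤ k then (S.map i k h).toLinearMap else 0

lemma map_self (i : ι) (x : G i) : S.map i i le_rfl x = x :=
  (S.map i i le_rfl).injective (S.map_map i i i le_rfl le_rfl x)

open Classical in
lemma push_single {i k : ι} (h : i ≤ k) (x : G i) :
    S.push k (DFinsupp.single i x) = S.map i k h x := by
  simp [push, h]

open Classical in
lemma push_eq (k : ι) (v : Π₀ i, G i) (s : Finset ι) (hs : v.support ⊆ s) :
    S.push k v = ∑ i ∈ s, (if h : i ≤ k then (S.map i k h).toLinearMap else 0) (v i) := by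
  have h1 : S.push k v = ∑ i ∈ v.support,
      (if h : i ≤ k then (S.map i k h).toLinearMap else 0) (v i) := by
    simp only [push, DFinsupp.lsum_apply_apply]
    rw [DFinsupp.sumAddHom_apply]
    rfl
  rw [h1]
  refine Finset.sum_subset hs fun i _ hi => ?_
  have : v i = 0 := by simpa using hi
  rw [this, map_zero]

open Classical in
lemma form_eq (k : ι) (v w : Π₀ i, G i) (hv : ∀ i ∈ v.support, i ≤ k)
    (hw : ∀ i ∈ w.support, i ≤ k) : S.form v w = inner ℂ (S.push k v) (S.push k w) := by
  rw [S.push_eq k v _ subset_rfl, S.push_eq k w _ subset_rfl, sum_inner]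
  refine Finset.sum_congr rfl fun i hi => ?_
  rw [inner_sum]
  refine Finset.sum_congr rfl fun j hj => ?_
  rw [dif_pos (hv i hi), dif_pos (hw j hj)]
  rw [← (S.map (i ⊔ j) k (sup_le (hv i hi) (hw j hj))).inner_map_map, S.map_map, S.map_map]
  rfl

open Classical in
lemma exists_bound [Nonempty ι] (l : List (Π₀ i, G i)) :
    ∃ k : ι, ∀ v ∈ l, ∀ i ∈ v.support, i ≤ k := by
  induction l with
  | nil => exact ⟨Classical.arbitrary ι, by simp⟩
  | cons a l ih =>
    obtain ⟨k, hk⟩ := ih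
    obtain ⟨m, hm⟩ := Finset.exists_le a.support
    refine ⟨k ⊔ m, fun v hv i hi => ?_⟩
    rcases List.mem_cons.1 hv with rfl | hv
    · exact (hm i hi).trans le_sup_right
    · exact (hk v hv i hi).trans le_sup_left

open Classical in
lemma form_of_isEmpty [IsEmpty ι] (v w : Π₀ i, G i) : S.form v w = 0 := by
  have : v.support = ∅ := Finset.eq_empty_of_isEmpty _
  rw [form, this, Finset.sum_empty]

lemma form_conj (v w : Π₀ i, G i) : (starRingEnd ℂ) (S.form w v) = S.form v w := by
  rcases isEmpty_or_nonempty ι with h | h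
  · rw [form_of_isEmpty, form_of_isEmpty, map_zero]
  · obtain ⟨k, hk⟩ := exists_bound (G := G) [v, w]
    simp only [List.mem_cons, List.not_mem_nil, or_false, forall_eq_or_imp, forall_eq] at hk
    rw [S.form_eq k v w hk.1 hk.2, S.form_eq k w v hk.2 hk.1, inner_conj_symm]

lemma form_nonneg (v : Π₀ i, G i) : 0 ≤ RCLike.re (S.form v v) := by
  rcases isEmpty_or_nonempty ι with h | h
  · rw [form_of_isEmpty, map_zero]
  · obtain ⟨k, hk⟩ := exists_bound (G := G) [v]
    simp only [List.mem_cons, List.not_mem_nil, or_false, forall_eq] at hk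
    rw [S.form_eq k v v hk hk]
    exact inner_self_nonneg

lemma form_add_left (u v w : Π₀ i, G i) : S.form (u + v) w = S.form u w + S.form v w := by
  rcases isEmpty_or_nonempty ι with h | h
  · simp only [form_of_isEmpty, add_zero]
  · obtain ⟨k, hk⟩ := exists_bound (G := G) [u, v, w, u + v]
    simp only [List.mem_cons, List.not_mem_nil, or_false, forall_eq_or_imp, forall_eq] at hk
    rw [S.form_eq k (u + v) w hk.2.2.2 hk.2.2.1, map_add, inner_add_left,
      ← S.form_eq k u w hk.1 hk.2.2.1, ← S.form_eq k v w hk.2.1 hk.2.2.1]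

lemma form_smul_left (v w : Π₀ i, G i) (r : ℂ) :
    S.form (r • v) w = (starRingEnd ℂ) r * S.form v w := by
  rcases isEmpty_or_nonempty ι with h | h
  · simp only [form_of_isEmpty, mul_zero]
  · obtain ⟨k, hk⟩ := exists_bound (G := G) [v, w, r • v]
    simp only [List.mem_cons, List.not_mem_nil, or_false, forall_eq_or_imp, forall_eq] at hk
    rw [S.form_eq k (r • v) w hk.2.2 hk.2.1, map_smul, inner_smul_left,
      ← S.form_eq k v w hk.1 hk.2.1]

/-- Semi-inner product space structure on representatives. -/
@[reducible]
def core : PreInnerProductSpace.Core ℂ S.Pre where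
  inner v w := S.form v w
  conj_inner_symm v w := S.form_conj v w
  re_inner_nonneg v := S.form_nonneg v
  add_left u v w := S.form_add_left u v w
  smul_left v w r := S.form_smul_left v w r

instance : SeminormedAddCommGroup S.Pre :=
  @InnerProductSpace.Core.toSeminormedAddCommGroup ℂ S.Pre _ _ _ S.core
instance : InnerProductSpace ℂ S.Pre := InnerProductSpace.ofCore S.core

lemma inner_pre (v w : S.Pre) : inner ℂ v w = S.form v w := rfl

/-- The Hilbert space direct limit: the Hausdorff completion of the algebraic direct limit.
(Mathlib's `Completion` of a semi-inner product space also divides out the vectors of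
seminorm `0`.) -/
abbrev Limit : Type _ := UniformSpace.Completion S.Pre

open Classical in
/-- The inclusion of representatives concentrated at the stage `i`. -/
def preOf (i : ι) : G i →ₗ[ℂ] S.Pre := (DFinsupp.lsingle i : G i →ₗ[ℂ] Π₀ i, G i)

open Classical in
lemma norm_preOf (i : ι) (x : G i) : ‖S.preOf i x‖ = ‖x‖ := by
  have hs : ∀ j ∈ (DFinsupp.single i x : Π₀ i, G i).support, j ≤ i := fun j hj => by
    have := DFinsupp.support_single_subset hj
    simp only [Finset.mem_singleton] at this
    exact this.le
  have h : inner ℂ (S.preOf i x) (S.preOf i x) = inner ℂ x x := by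
    have e := S.form_eq i (DFinsupp.single i x) (DFinsupp.single i x) hs hs
    rw [S.push_single le_rfl, S.map_self] at e
    exact e
  rw [@norm_eq_sqrt_re_inner ℂ, h, ← @norm_eq_sqrt_re_inner ℂ]

/-- The canonical isometry of the stage `i` into the direct limit. -/
def of (i : ι) : G i →ₗᵢ[ℂ] S.Limit :=
  (UniformSpace.Completion.toComplₗᵢ (𝕜 := ℂ) (E := S.Pre)).comp ⟨S.preOf i, S.norm_preOf i⟩

lemma of_apply (i : ι) (x : G i) : S.of i x = (S.preOf i x : S.Limit) := rfl

open Classical in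
/-- The canonical isometries are compatible with the connecting maps. -/
lemma of_map (i j : ι) (h : i ≤ j) (x : G i) : S.of j (S.map i j h x) = S.of i x := by
  rw [← sub_eq_zero, ← norm_eq_zero, of_apply, of_apply, ← UniformSpace.Completion.coe_sub,
    UniformSpace.Completion.norm_coe, @norm_eq_sqrt_re_inner ℂ]
  have hs : ∀ k ∈ (DFinsupp.single j (S.map i j h x) - DFinsupp.single i x :
      Π₀ i, G i).support, k ≤ j := fun k hk => by
    by_contra hkj
    have h1 : j ≠ k := fun e => hkj e.ge
    have h2 : i ≠ k := fun e => hkj (e ▸ h)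
    rw [DFinsupp.mem_support_toFun] at hk
    apply hk
    rw [DFinsupp.sub_apply, DFinsupp.single_eq_of_ne h1.symm, DFinsupp.single_eq_of_ne h2.symm,
      sub_zero]
  have e := S.form_eq j _ _ hs hs
  rw [map_sub, S.push_single le_rfl, S.push_single h, S.map_self, sub_self, inner_zero_left] at e
  have e2 : inner ℂ (S.preOf j (S.map i j h x) - S.preOf i x)
    (S.preOf j (S.map i j h x) - S.preOf i x) = 0 := e
  rw [e2, map_zero, Real.sqrt_zero]

open Classical in
/-- If all connecting maps are onto, every stage is mapped onto the direct limit. -/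
lemma of_surjective [∀ i, CompleteSpace (G i)]
    (hS : ∀ i j h, Function.Surjective (S.map i j h)) (i : ι) :
    Function.Surjective (S.of i) := by
  have hc : IsClosed (Set.range (S.of i)) := (S.of i).isometry.isClosedEmbedding.isClosed_range
  have key : ∀ v : S.Pre, (v : S.Limit) ∈ LinearMap.range (S.of i).toLinearMap := by
    refine fun v => DFinsupp.induction (p := fun v : Π₀ i, G i =>
      UniformSpace.Completion.coe' (α := S.Pre) v ∈ LinearMap.range (S.of i).toLinearMap) v
      (zero_mem _) ?_
    intro j b f _ _ hf
    have hb : S.of j b ∈ LinearMap.range (S.of i).toLinearMap := by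
      obtain ⟨c, hc⟩ := hS i (i ⊔ j) le_sup_left (S.map j (i ⊔ j) le_sup_right b)
      refine ⟨c, ?_⟩
      rw [← S.of_map j (i ⊔ j) le_sup_right, ← hc]
      exact (S.of_map i (i ⊔ j) le_sup_left c).symm
    have h3 := add_mem hb hf
    rw [of_apply] at h3
    exact (UniformSpace.Completion.coe_add (S.preOf j b) (show S.Pre from f)).symm ▸ h3
  intro y
  change y ∈ Set.range (S.of i)
  induction y using UniformSpace.Completion.induction_on with
  | hp => exact hc
  | ih v => exact key v

/-- When the connecting maps are unitaries, so are the canonical maps into the limit. -/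
def ofEquiv [∀ i, CompleteSpace (G i)] (hS : ∀ i j h, Function.Surjective (S.map i j h)) (i : ι) :
    G i ≃ₗᵢ[ℂ] S.Limit :=
  LinearIsometryEquiv.ofSurjective (S.of i) (S.of_surjective hS i)

end HilbertSystem

/-- A unitary between semi-inner product spaces extends to the Hausdorff completions. -/
def completionEquiv {E F : Type*} [SeminormedAddCommGroup E] [InnerProductSpace ℂ E]
    [SeminormedAddCommGroup F] [InnerProductSpace ℂ F] (e : E ≃ₗᵢ[ℂ] F) :
    UniformSpace.Completion E ≃ₗᵢ[ℂ] UniformSpace.Completion F where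
  toLinearEquiv := LinearEquiv.ofLinearMap
    (ContinuousLinearMap.completion (e : E →L[ℂ] F)).toLinearMap
    (ContinuousLinearMap.completion (e.symm : F →L[ℂ] E)).toLinearMap
    (by
      ext x
      induction x using UniformSpace.Completion.induction_on with
      | hp => exact isClosed_eq (by simp; fun_prop) (by simp; fun_prop)
      | ih x => simp)
    (by
      ext x
      induction x using UniformSpace.Completion.induction_on with
      | hp => exact isClosed_eq (by simp; fun_prop) (by simp; fun_prop)
      | ih x => simp)
  norm_map' x := by
    induction x using UniformSpace.Completion.induction_on with
    | hp => exact isClosed_eq (by simp; fun_prop) (by fun_prop)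
    | ih x => simp

lemma completionEquiv_coe {E F : Type*} [SeminormedAddCommGroup E] [InnerProductSpace ℂ E]
    [SeminormedAddCommGroup F] [InnerProductSpace ℂ F] (e : E ≃ₗᵢ[ℂ] F) (x : E) :
    completionEquiv e (x : UniformSpace.Completion E) = (e x : UniformSpace.Completion F) := by
  simp [completionEquiv]

/-! ## Extension of bounded functions to the Stone-Čech compactification -/

/-- The continuous extension to `βX` of a bounded continuous function on `X`. -/
def betaExtend {X : Type*} [TopologicalSpace X] (f : X →ᵇ ℂ) (t : StoneCech X) : ℂ :=
  (stoneCechExtend (β := Metric.closedBall (0 : ℂ) ‖f‖)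
    (g := fun x => ⟨f x, by simpa using f.norm_coe_le_norm x⟩)
    (f.continuous.subtype_mk fun x => by simpa using f.norm_coe_le_norm x) t : ℂ)

lemma continuous_betaExtend {X : Type*} [TopologicalSpace X] (f : X →ᵇ ℂ) :
    Continuous (betaExtend f) :=
  continuous_subtype_val.comp (continuous_stoneCechExtend _)

lemma betaExtend_unit {X : Type*} [TopologicalSpace X] (f : X →ᵇ ℂ) (x : X) :
    betaExtend f (stoneCechUnit x) = f x := by
  simp [betaExtend, stoneCechExtend_stoneCechUnit]

lemma betaExtend_unique {X : Type*} [TopologicalSpace X] (f : X →ᵇ ℂ) {g : StoneCech X → ℂ}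
    (hg : Continuous g) (h : ∀ x, g (stoneCechUnit x) = f x) : g = betaExtend f :=
  stoneCech_hom_ext hg (continuous_betaExtend f) (funext fun x => by
    simp [h, betaExtend_unit])

/-! ## Vector fields, operator fields, continuous Hilbert bundles -/

section Fields

variable {T : Type*} [TopologicalSpace T] {H : T → Type*} [∀ t, NormedAddCommGroup (H t)]
  [∀ t, InnerProductSpace ℂ (H t)]

/-- The local uniform limits of the vector fields in `E`. -/
def localUniformLimits (E : Submodule ℂ (∀ t, H t)) : Submodule ℂ (∀ t, H t) where
  carrier := {ξ | ∀ t₀ : T, ∀ ε : ℝ, 0 < ε →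
    ∃ U : Set T, IsOpen U ∧ t₀ ∈ U ∧ ∃ ω ∈ E, ∀ t ∈ U, ‖ω t - ξ t‖ < ε}
  zero_mem' := fun t₀ ε hε => ⟨Set.univ, isOpen_univ, trivial, 0, zero_mem _,
    fun t _ => by simpa using hε⟩
  add_mem' := by
    intro ξ η hξ hη t₀ ε hε
    obtain ⟨U, hU, htU, ω, hω, h1⟩ := hξ t₀ (ε / 2) (half_pos hε)
    obtain ⟨V, hV, htV, ν, hν, h2⟩ := hη t₀ (ε / 2) (half_pos hε)
    refine ⟨U ∩ V, hU.inter hV, ⟨htU, htV⟩, ω + ν, add_mem hω hν, fun t ht => ?_⟩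
    have : (ω + ν) t - (ξ + η) t = (ω t - ξ t) + (ν t - η t) := by
      simp only [Pi.add_apply]; abel
    rw [this]
    linarith [norm_add_le (ω t - ξ t) (ν t - η t), h1 t ht.1, h2 t ht.2]
  smul_mem' := by
    intro c ξ hξ t₀ ε hε
    have hc : (0 : ℝ) < ‖c‖ + 1 := by positivity
    obtain ⟨U, hU, htU, ω, hω, h1⟩ := hξ t₀ (ε / (‖c‖ + 1)) (div_pos hε hc)
    refine ⟨U, hU, htU, c • ω, Submodule.smul_mem _ _ hω, fun t ht => ?_⟩
    have : (c • ω) t - (c • ξ) t = c • (ω t - ξ t) := by simp [smul_sub]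
    rw [this, norm_smul]
    have h2 := h1 t ht
    rw [lt_div_iff₀ hc] at h2
    nlinarith [norm_nonneg (ω t - ξ t), norm_nonneg c]

/-- The bounded vector fields in `Ω`, as a subspace of the Banach space of all bounded vector
fields with the supremum norm. -/
def boundedFields (Ω : Submodule ℂ (∀ t, H t)) : Submodule ℂ (lp H ∞) where
  carrier := {ω | (ω : ∀ t, H t) ∈ Ω}
  zero_mem' := zero_mem Ω
  add_mem' := fun h₁ h₂ => add_mem (S := Submodule ℂ (∀ t, H t)) h₁ h₂
  smul_mem' := fun c _ h => Submodule.smul_mem Ω c h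

variable (H) in
/-- The bounded operator fields, with pointwise operations and the supremum norm. -/
abbrev OpField : Type _ := lp (fun t => H t →L[ℂ] H t) ∞

/-- The orthogonal projection onto the span of finitely many vectors. -/
def spanProj {E : Type*} [NormedAddCommGroup E] [InnerProductSpace ℂ E] {n : ℕ} (v : Fin n → E) :
    E →L[ℂ] E :=
  haveI : FiniteDimensional ℂ (Submodule.span ℂ (Set.range v)) :=
    FiniteDimensional.span_of_finite ℂ (Set.finite_range v)
  (Submodule.span ℂ (Set.range v)).starProjection

/-- Almost finite-dimensional operator fields, with respect to the vector fields in `Ω`. -/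
def AlmostFiniteDimensional (Ω : Submodule ℂ (∀ t, H t)) (a : ∀ t, H t →L[ℂ] H t) : Prop :=
  ∀ t₀ : T, ∀ ε : ℝ, 0 < ε → ∃ U : Set T, IsOpen U ∧ t₀ ∈ U ∧
    ∃ (n : ℕ) (ω : Fin n → ∀ t, H t), (∀ i, ω i ∈ Ω) ∧
      ∀ t ∈ U, LinearIndependent ℂ (fun i => ω i t) ∧
        ‖spanProj (fun i => ω i t) ∘L a t ∘L spanProj (fun i => ω i t) - a t‖ < ε

/-- Weakly continuous operator fields. (Mathlib's inner product is linear in the second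
variable.) -/
def WeaklyContinuous (Ω : Submodule ℂ (∀ t, H t)) (a : ∀ t, H t →L[ℂ] H t) : Prop :=
  ∀ ω₁ ∈ Ω, ∀ ω₂ ∈ Ω, Continuous fun t => inner ℂ (ω₂ t) (a t (ω₁ t))

/-- The Fell algebra `A(T, {H_t}, Ω)`: all weakly continuous almost finite-dimensional operator
fields whose norm function is continuous and vanishes at infinity. -/
def fellAlgebra (Ω : Submodule ℂ (∀ t, H t)) : Set (OpField H) :=
  {a | WeaklyContinuous Ω a ∧ AlmostFiniteDimensional Ω a ∧ (Continuous fun t => ‖a t‖) ∧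
    Tendsto (fun t => ‖a t‖) (cocompact T) (𝓝 0)}

end Fields

/-- A continuous Hilbert bundle over `T` with fibres `H t`. -/
structure ContinuousHilbertBundle (T : Type*) [TopologicalSpace T] (H : T → Type*)
    [∀ t, NormedAddCommGroup (H t)] [∀ t, InnerProductSpace ℂ (H t)] where
  Ω : Submodule ℂ (∀ t, H t)
  smul_mem : ∀ (f : C(T, ℂ)), ∀ ω ∈ Ω, (fun t => f t • ω t) ∈ Ω
  eval_surjective : ∀ (t : T) (v : H t), ∃ ω ∈ Ω, ω t = v
  continuous_norm : ∀ ω ∈ Ω, Continuous fun t => ‖ω t‖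
  local_uniform : localUniformLimits Ω ≤ Ω

/-! ## Adjointable and compact operators on a module of bounded vector fields -/

section Operators

variable {T : Type*} {H : T → Type*} [∀ t, NormedAddCommGroup (H t)]
  [∀ t, InnerProductSpace ℂ (H t)] (W : Submodule ℂ (lp H ∞))

/-- The bounded adjointable endomorphisms `B(W)` of a module `W` of bounded vector fields, with
respect to the function-valued inner product `⟨ξ, η⟩(t) = ⟨ξ(t), η(t)⟩`. (An adjointable map
automatically commutes with every multiplication by a function that leaves `W` invariant.) -/
def adjointable : Subalgebra ℂ (W →L[ℂ] W) where
  carrier := {k | ∃ k' : W →L[ℂ] W, ∀ (ξ η : W) (t : T),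
    inner ℂ ((k ξ : lp H ∞) t) ((η : lp H ∞) t) = inner ℂ ((ξ : lp H ∞) t) ((k' η : lp H ∞) t)}
  mul_mem' := by
    rintro k l ⟨k', hk⟩ ⟨l', hl⟩
    exact ⟨l' * k', fun ξ η t => by
      change inner ℂ ((k (l ξ) : lp H ∞) t) _ = inner ℂ _ ((l' (k' η) : lp H ∞) t)
      rw [hk, hl]⟩
  add_mem' := by
    rintro k l ⟨k', hk⟩ ⟨l', hl⟩
    exact ⟨k' + l', fun ξ η t => by
      change inner ℂ ((k ξ : lp H ∞) t + (l ξ : lp H ∞) t) _ =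
        inner ℂ _ ((k' η : lp H ∞) t + (l' η : lp H ∞) t)
      rw [inner_add_left, inner_add_right, hk, hl]⟩
  algebraMap_mem' := fun r => ⟨(starRingEnd ℂ r) • 1, fun ξ η t => by
    change inner ℂ (r • (ξ : lp H ∞) t) _ = inner ℂ _ ((starRingEnd ℂ r) • (η : lp H ∞) t)
    rw [inner_smul_left, inner_smul_right]⟩

variable {W}

/-- Adjoints are unique. -/
lemma adjoint_unique {k k' k'' : W →L[ℂ] W}
    (h' : ∀ (ξ η : W) (t : T), inner ℂ ((k ξ : lp H ∞) t) ((η : lp H ∞) t) =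
      inner ℂ ((ξ : lp H ∞) t) ((k' η : lp H ∞) t))
    (h'' : ∀ (ξ η : W) (t : T), inner ℂ ((k ξ : lp H ∞) t) ((η : lp H ∞) t) =
      inner ℂ ((ξ : lp H ∞) t) ((k'' η : lp H ∞) t)) : k' = k'' := by
  ext η t
  have h := fun ξ => (h' ξ η t).symm.trans (h'' ξ η t)
  have h2 := h (k' η - k'' η)
  rw [← sub_eq_zero, ← inner_sub_right] at h2
  exact sub_eq_zero.1 (inner_self_eq_zero (𝕜 := ℂ).1 h2)

lemma adjoint_mem {k k' : W →L[ℂ] W}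
    (h : ∀ (ξ η : W) (t : T), inner ℂ ((k ξ : lp H ∞) t) ((η : lp H ∞) t) =
      inner ℂ ((ξ : lp H ∞) t) ((k' η : lp H ∞) t)) : k' ∈ adjointable W :=
  ⟨k, fun ξ η t => by rw [← inner_conj_symm, ← h, inner_conj_symm]⟩

/-- The involution of `B(W)`: `star k` is the adjoint of `k`. -/
instance : Star (adjointable W) where
  star k := ⟨k.2.choose, adjoint_mem k.2.choose_spec⟩

lemma star_adjointable_spec (k : adjointable W) (ξ η : W) (t : T) :
    inner ℂ ((k.1 ξ : lp H ∞) t) ((η : lp H ∞) t) =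
      inner ℂ ((ξ : lp H ∞) t) (((star k).1 η : lp H ∞) t) :=
  k.2.choose_spec ξ η t

variable (W)

/-- The finite-rank endomorphisms: finite sums of the maps
`Θ_{ω,ν} ξ = ⟨ξ, ν⟩ · ω`, where `⟨ξ, ν⟩` is linear in `ξ`. -/
def finiteRank : Set (adjointable W) :=
  {k | ∃ (n : ℕ) (ω ν : Fin n → W), ∀ (ξ : W) (t : T),
    (k.1 ξ : lp H ∞) t =
      ∑ i, (inner ℂ ((ν i : lp H ∞) t) ((ξ : lp H ∞) t) : ℂ) • ((ω i : lp H ∞) t)}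

/-- The compact endomorphisms `K(W)`: the norm closure of the finite-rank endomorphisms. -/
def compactOps : Set (adjointable W) := closure (finiteRank W)

end Operators

/-! ## Essential ideals and the bundles over the Stone-Čech compactifications -/

namespace ContinuousHilbertBundle

universe u v

variable {T : Type u} [TopologicalSpace T] {H : T → Type v} [∀ t, NormedAddCommGroup (H t)]
  [∀ t, InnerProductSpace ℂ (H t)]

/-- The norm-closed two-sided ideals of the Fell algebra `A` of the bundle. -/
def IsClosedIdeal (B : ContinuousHilbertBundle T H) (I : Submodule ℂ (OpField H)) : Prop :=
  (I : Set (OpField H)) ⊆ fellAlgebra B.Ω ∧ IsClosed (I : Set (OpField H)) ∧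
    ∀ a ∈ fellAlgebra B.Ω, ∀ b ∈ I, a * b ∈ I ∧ b * a ∈ I

/-- The essential ideals of the Fell algebra of the bundle. -/
structure EssIdeal (B : ContinuousHilbertBundle T H) where
  ideal : Submodule ℂ (OpField H)
  isClosedIdeal : B.IsClosedIdeal ideal
  essential : ∀ J : Submodule ℂ (OpField H), B.IsClosedIdeal J → J ≠ ⊥ → ideal ⊓ J ≠ ⊥

variable {B : ContinuousHilbertBundle T H}

lemma IsClosedIdeal.inf {I J : Submodule ℂ (OpField H)} (hI : B.IsClosedIdeal I)
    (hJ : B.IsClosedIdeal J) : B.IsClosedIdeal (I ⊓ J) :=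
  ⟨fun _ hx => hI.1 hx.1, hI.2.1.inter hJ.2.1, fun a ha b hb =>
    ⟨⟨(hI.2.2 a ha b hb.1).1, (hJ.2.2 a ha b hb.2).1⟩,
      ⟨(hI.2.2 a ha b hb.1).2, (hJ.2.2 a ha b hb.2).2⟩⟩⟩

namespace EssIdeal

lemma ext_ideal {I J : B.EssIdeal} (h : I.ideal = J.ideal) : I = J := by
  cases I; cases J; cases h; rfl

/-- The essential ideals are directed by reverse inclusion: `J ≤ I` means `I ⊆ J`. The supremum
of two essential ideals is their intersection. -/
instance : SemilatticeSup B.EssIdeal where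
  le J I := I.ideal ≤ J.ideal
  le_refl I := le_refl I.ideal
  le_trans _ _ _ h₁ h₂ := le_trans h₂ h₁
  le_antisymm _ _ h₁ h₂ := ext_ideal (le_antisymm h₂ h₁)
  sup I J := ⟨I.ideal ⊓ J.ideal, I.isClosedIdeal.inf J.isClosedIdeal, fun K hK hK0 => by
    rw [inf_assoc]
    exact I.essential _ (J.isClosedIdeal.inf hK) (J.essential K hK hK0)⟩
  le_sup_left I J := (inf_le_left : I.ideal ⊓ J.ideal ≤ I.ideal)
  le_sup_right I J := (inf_le_right : I.ideal ⊓ J.ideal ≤ J.ideal)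
  sup_le _ _ _ h₁ h₂ := le_inf h₁ h₂

lemma le_def {I J : B.EssIdeal} : J ≤ I ↔ I.ideal ≤ J.ideal := Iff.rfl

/-- The open set `X^I`: the complement of the common zero set of the operator fields in `I`. -/
def X (I : B.EssIdeal) : Set T := {t | ∀ b ∈ I.ideal, b t = 0}ᶜ

lemma X_mono {I J : B.EssIdeal} (h : J ≤ I) : I.X ⊆ J.X :=
  Set.compl_subset_compl.2 fun _ ht b hb => ht b (h hb)

/-- The Stone-Čech compactification `βX^I`. -/
abbrev beta (I : B.EssIdeal) : Type u := StoneCech I.X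

lemma continuous_incl {I J : B.EssIdeal} (h : J ≤ I) :
    Continuous fun x : I.X => (stoneCechUnit (Set.inclusion (X_mono h) x) : J.beta) :=
  continuous_stoneCechUnit.comp (continuous_inclusion _)

/-- The map `Φ_{JI} : βX^I → βX^J` extending the inclusion `X^I ⊆ X^J`. -/
def Phi {I J : B.EssIdeal} (h : J ≤ I) : I.beta → J.beta := stoneCechExtend (continuous_incl h)

lemma continuous_Phi {I J : B.EssIdeal} (h : J ≤ I) : Continuous (Phi h) :=
  continuous_stoneCechExtend _

lemma Phi_unit {I J : B.EssIdeal} (h : J ≤ I) (x : I.X) :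
    Phi h (stoneCechUnit x) = stoneCechUnit (Set.inclusion (X_mono h) x) :=
  stoneCechExtend_stoneCechUnit _ _

lemma Phi_Phi {I J K : B.EssIdeal} (h : J ≤ I) (h' : K ≤ J) (t : I.beta) :
    Phi h' (Phi h t) = Phi (h'.trans h) t := by
  have : Phi h' ∘ Phi h = Phi (h'.trans h) :=
    stoneCech_hom_ext ((continuous_Phi _).comp (continuous_Phi _)) (continuous_Phi _)
      (funext fun x => by simp [Phi_unit])
  exact congrFun this t

end EssIdeal

variable (B)

lemma continuous_inner_fields {ω ν : ∀ t, H t} (hω : ω ∈ B.Ω) (hν : ν ∈ B.Ω) :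
    Continuous fun t => inner ℂ (ω t) (ν t) := by
  simp only [inner_eq_sum_norm_sq_div_four]
  have h1 := B.continuous_norm _ (add_mem hω hν)
  have h2 := B.continuous_norm _ (sub_mem hω hν)
  have h3 := B.continuous_norm _ (sub_mem hω (B.Ω.smul_mem (RCLike.I : ℂ) hν))
  have h4 := B.continuous_norm _ (add_mem hω (B.Ω.smul_mem (RCLike.I : ℂ) hν))
  simp only [Pi.add_apply, Pi.sub_apply, Pi.smul_apply] at h1 h2 h3 h4
  fun_prop

/-- The bounded continuous function `t ↦ ⟨ω(t), ν(t)⟩` on `X`, for bounded `ω, ν` in `Ω`. -/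
def innerFun (X : Set T) (ω ν : boundedFields B.Ω) : X →ᵇ ℂ :=
  BoundedContinuousFunction.ofNormedAddCommGroup
    (fun t : X => inner ℂ ((ω : lp H ∞) t) ((ν : lp H ∞) t))
    ((B.continuous_inner_fields ω.2 ν.2).comp continuous_subtype_val)
    (‖(ω : lp H ∞)‖ * ‖(ν : lp H ∞)‖) fun t =>
      (norm_inner_le_norm _ _).trans (mul_le_mul (lp.norm_apply_le_norm (by simp) _ _)
        (lp.norm_apply_le_norm (by simp) _ _) (norm_nonneg _) (norm_nonneg _))

variable {B}

/-- The bounded vector fields in `Ω`, with the semi-inner product at `t ∈ βX^I` that is the value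
at `t` of the continuous extension of `⟨ω(·), ν(·)⟩|_{X^I}`. (It only depends on the restrictions
of the fields to `X^I`.) -/
def PreFibre (I : B.EssIdeal) (_t : I.beta) : Type _ := boundedFields B.Ω

namespace PreFibre

variable {I : B.EssIdeal} {t : I.beta}

instance : AddCommGroup (PreFibre I t) := inferInstanceAs (AddCommGroup (boundedFields B.Ω))
instance : Module ℂ (PreFibre I t) := inferInstanceAs (Module ℂ (boundedFields B.Ω))

/-- The extended inner product at `t`. -/
def form (I : B.EssIdeal) (t : I.beta) (ω ν : boundedFields B.Ω) : ℂ :=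
  betaExtend (B.innerFun I.X ω ν) t

lemma continuous_form (ω ν : boundedFields B.Ω) : Continuous fun t => form I t ω ν :=
  continuous_betaExtend _

lemma form_unit (x : I.X) (ω ν : boundedFields B.Ω) :
    form I (stoneCechUnit x) ω ν = inner ℂ ((ω : lp H ∞) x) ((ν : lp H ∞) x) :=
  betaExtend_unit _ _

/-- Identities between extended inner products need only be checked on `X^I`. -/
lemma eq_of_unit {p q : I.beta → ℂ} (hp : Continuous p) (hq : Continuous q)
    (h : ∀ x : I.X, p (stoneCechUnit x) = q (stoneCechUnit x)) (t : I.beta) : p t = q t :=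
  congrFun (stoneCech_hom_ext hp hq (funext h)) t

lemma form_Phi {J : B.EssIdeal} (h : J ≤ I) (t : I.beta) (ω ν : boundedFields B.Ω) :
    form J (EssIdeal.Phi h t) ω ν = form I t ω ν := by
  refine eq_of_unit (p := fun t => form J (EssIdeal.Phi h t) ω ν) (q := fun t => form I t ω ν)
    ((continuous_form ω ν).comp (EssIdeal.continuous_Phi h)) (continuous_form ω ν)
    (fun x => ?_) t
  simp only [EssIdeal.Phi_unit, form_unit, Set.coe_inclusion]

lemma form_conj (ω ν : boundedFields B.Ω) :
    (starRingEnd ℂ) (form I t ν ω) = form I t ω ν := by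
  refine eq_of_unit (p := fun t => (starRingEnd ℂ) (form I t ν ω))
    (q := fun t => form I t ω ν) (Complex.continuous_conj.comp (continuous_form _ _))
    (continuous_form _ _) (fun x => ?_) t
  simp only [form_unit, inner_conj_symm]

lemma form_nonneg (ω : boundedFields B.Ω) : 0 ≤ RCLike.re (form I t ω ω) := by
  have hc : IsClosed {t : I.beta | 0 ≤ RCLike.re (form I t ω ω)} :=
    isClosed_le continuous_const (RCLike.continuous_re.comp (continuous_form _ _))
  have : (Set.range (stoneCechUnit : I.X → I.beta)) ⊆
      {t : I.beta | 0 ≤ RCLike.re (form I t ω ω)} := by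
    rintro _ ⟨x, rfl⟩
    change 0 ≤ RCLike.re (form I (stoneCechUnit x) ω ω)
    rw [form_unit]
    exact inner_self_nonneg
  have h2 := closure_minimal this hc
  rw [denseRange_stoneCechUnit.closure_range] at h2
  exact h2 (Set.mem_univ t)

lemma form_add_left (ω ω' ν : boundedFields B.Ω) :
    form I t (ω + ω') ν = form I t ω ν + form I t ω' ν := by
  refine eq_of_unit (p := fun t => form I t (ω + ω') ν)
    (q := fun t => form I t ω ν + form I t ω' ν) (continuous_form _ _)
    ((continuous_form _ _).add (continuous_form _ _)) (fun x => ?_) t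
  simp only [form_unit]
  exact inner_add_left _ _ _

lemma form_smul_left (ω ν : boundedFields B.Ω) (r : ℂ) :
    form I t (r • ω) ν = (starRingEnd ℂ) r * form I t ω ν := by
  refine eq_of_unit (p := fun t => form I t (r • ω) ν)
    (q := fun t => (starRingEnd ℂ) r * form I t ω ν) (continuous_form _ _)
    (continuous_const.mul (continuous_form _ _)) (fun x => ?_) t
  simp only [form_unit]
  exact inner_smul_left _ _ _

variable (I t) in
/-- The semi-inner product space structure at `t`. -/
@[reducible]
def core : PreInnerProductSpace.Core ℂ (PreFibre I t) where
  inner ω ν := form I t ω ν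
  conj_inner_symm ω ν := form_conj (I := I) (t := t) ω ν
  re_inner_nonneg ω := form_nonneg (I := I) (t := t) ω
  add_left ω ω' ν := form_add_left (I := I) (t := t) ω ω' ν
  smul_left ω ν r := form_smul_left (I := I) (t := t) ω ν r

instance : SeminormedAddCommGroup (PreFibre I t) :=
  @InnerProductSpace.Core.toSeminormedAddCommGroup ℂ (PreFibre I t) _ _ _ (core I t)
instance : InnerProductSpace ℂ (PreFibre I t) := InnerProductSpace.ofCore (core I t)

lemma inner_def (ω ν : PreFibre I t) : inner ℂ ω ν = form I t ω ν := rfl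

/-- The identity of the space of bounded vector fields, as a unitary from the semi-inner product
at `Φ_{JI}(t)` to the one at `t`. -/
def transfer {J : B.EssIdeal} (h : J ≤ I) (t : I.beta) :
    PreFibre J (EssIdeal.Phi h t) ≃ₗᵢ[ℂ] PreFibre I t where
  toLinearEquiv := LinearEquiv.refl ℂ (boundedFields B.Ω)
  norm_map' ω := congrArg (fun z : ℂ => √(RCLike.re z)) (form_Phi h t ω ω).symm

end PreFibre

/-- The Hilbert space `H_t^I`: the completion of the bounded vector fields modulo the null space
of the semi-inner product at `t ∈ βX^I`. -/
abbrev Fibre (I : B.EssIdeal) (t : I.beta) : Type _ := UniformSpace.Completion (PreFibre I t)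

/-- The vector field `ω̄^I` on `βX^I`, as a linear function of `ω`. -/
def bar (I : B.EssIdeal) : boundedFields B.Ω →ₗ[ℂ] (∀ t : I.beta, Fibre I t) where
  toFun ω t := ((show PreFibre I t from ω) : Fibre I t)
  map_add' _ _ := funext fun t => UniformSpace.Completion.coe_add (α := PreFibre I t) _ _
  map_smul' r _ := funext fun t => UniformSpace.Completion.coe_smul (X := PreFibre I t) r _

/-- `Ω^I`: the local uniform limits of the vector fields `ω̄^I`. -/
def OmegaI (I : B.EssIdeal) : Submodule ℂ (∀ t : I.beta, Fibre I t) :=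
  localUniformLimits (LinearMap.range (bar I))

/-- The unitary `Ψ_{JIt} : H^J_{Φ_{JI}(t)} → H^I_t`, `ω̄^J(Φ_{JI}(t)) ↦ ω̄^I(t)`. -/
def Psi {I J : B.EssIdeal} (h : J ≤ I) (t : I.beta) :
    Fibre J (EssIdeal.Phi h t) ≃ₗᵢ[ℂ] Fibre I t :=
  completionEquiv (PreFibre.transfer h t)

lemma Psi_bar {I J : B.EssIdeal} (h : J ≤ I) (t : I.beta) (ω : boundedFields B.Ω) :
    Psi h t (bar J ω (EssIdeal.Phi h t)) = bar I ω t :=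
  completionEquiv_coe _ _

/-! ## The direct limit bundle -/

variable (B)

/-- The inverse limit `Δ` of the compact spaces `βX^I`, with its inverse limit topology. -/
def Delta : Type _ :=
  {s : ∀ I : B.EssIdeal, I.beta // ∀ (J I : B.EssIdeal) (h : J ≤ I), s J = EssIdeal.Phi h (s I)}

instance : TopologicalSpace B.Delta :=
  inferInstanceAs (TopologicalSpace {s : ∀ I : B.EssIdeal, I.beta //
    ∀ (J I : B.EssIdeal) (h : J ≤ I), s J = EssIdeal.Phi h (s I)})

variable {B}

/-- The projection `Φ_I : Δ → βX^I`. -/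
def Delta.proj (s : B.Delta) (I : B.EssIdeal) : I.beta := s.1 I

lemma Delta.proj_eq (s : B.Delta) {I J : B.EssIdeal} (h : J ≤ I) :
    s.proj J = EssIdeal.Phi h (s.proj I) := s.2 J I h

/-- Transport along an equality of base points. -/
def fibreCast (I : B.EssIdeal) {t t' : I.beta} (h : t = t') : Fibre I t ≃ₗᵢ[ℂ] Fibre I t' :=
  h ▸ LinearIsometryEquiv.refl ℂ (Fibre I t)

lemma fibreCast_bar (I : B.EssIdeal) {t t' : I.beta} (h : t = t') (ω : boundedFields B.Ω) :
    fibreCast I h (bar I ω t) = bar I ω t' := by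
  subst h; rfl

/-- The connecting unitary `Ψ_{JIΦ_I(s)} : H^J_{Φ_J(s)} → H^I_{Φ_I(s)}`. -/
def connect (s : B.Delta) (J I : B.EssIdeal) (h : J ≤ I) :
    Fibre J (s.proj J) ≃ₗᵢ[ℂ] Fibre I (s.proj I) :=
  (fibreCast J (s.proj_eq h)).trans (Psi h (s.proj I))

lemma connect_bar (s : B.Delta) (J I : B.EssIdeal) (h : J ≤ I) (ω : boundedFields B.Ω) :
    connect s J I h (bar J ω (s.proj J)) = bar I ω (s.proj I) := by
  simp only [connect, LinearIsometryEquiv.trans_apply, fibreCast_bar, Psi_bar]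

lemma connect_connect (s : B.Delta) (K J I : B.EssIdeal) (h : K ≤ J) (h' : J ≤ I)
    (x : Fibre K (s.proj K)) :
    connect s J I h' (connect s K J h x) = connect s K I (h.trans h') x := by
  induction x using UniformSpace.Completion.induction_on with
  | hp => exact isClosed_eq (by fun_prop) (by fun_prop)
  | ih ω =>
    have := connect_bar s J I h' ω
    rw [← connect_bar s K J h ω] at this
    exact this.trans (connect_bar s K I (h.trans h') ω).symm

/-- The direct system of Hilbert spaces `H^I_{Φ_I(s)}` and unitaries at `s ∈ Δ`. -/
def system (s : B.Delta) : HilbertSystem B.EssIdeal (fun I => Fibre I (s.proj I)) where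
  map J I h := (connect s J I h).toLinearIsometry
  map_map K J I h h' x := connect_connect s K J I h h' x

/-- The Hilbert space `H_s^Δ = lim H^I_{Φ_I(s)}`. -/
abbrev DeltaFibre (s : B.Delta) : Type _ := (system s).Limit

/-- The canonical unitary `Ψ_{I,s} : H^I_{Φ_I(s)} → H_s^Δ`. -/
def toLimit (I : B.EssIdeal) (s : B.Delta) : Fibre I (s.proj I) ≃ₗᵢ[ℂ] DeltaFibre s :=
  (system s).ofEquiv (fun J I h => (connect s J I h).surjective) I

/-- The vector field `ν ∘ Φ_I`, that is `s ↦ Ψ_{I,s} ν(Φ_I(s))`, on `Δ`. -/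
def pullField (I : B.EssIdeal) :
    (∀ t : I.beta, Fibre I t) →ₗ[ℂ] (∀ s : B.Delta, DeltaFibre s) where
  toFun ν s := toLimit I s (ν (s.proj I))
  map_add' _ _ := funext fun s => map_add (toLimit I s) _ _
  map_smul' r _ := funext fun s => map_smul (toLimit I s) r _

variable (B)

/-- The algebraic direct limit of the spaces `Ω^I`: the union of the directed family of subspaces
`{ν ∘ Φ_I | ν ∈ Ω^I}`, written as their supremum. -/
def algLimit : Submodule ℂ (∀ s : B.Delta, DeltaFibre s) :=
  ⨆ I : B.EssIdeal, (OmegaI I).map (pullField I)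

/-- `Ω^Δ`: the bounded vector fields on `Δ` that are local uniform limits of fields in the
algebraic direct limit. -/
def OmegaDelta : Submodule ℂ (∀ s : B.Delta, DeltaFibre s) where
  carrier := {ξ | Memℓp ξ ∞ ∧ ξ ∈ localUniformLimits B.algLimit}
  zero_mem' := ⟨zero_memℓp, zero_mem _⟩
  add_mem' := fun h₁ h₂ => ⟨h₁.1.add h₂.1, add_mem h₁.2 h₂.2⟩
  smul_mem' := fun c _ h => ⟨h.1.const_smul c, Submodule.smul_mem _ c h.2⟩

variable {B}

/-- The operator field `a ∘ Φ_I`, that is `s ↦ Ψ_{I,s} a(Φ_I(s)) Ψ_{I,s}⁻¹`, on `Δ`. -/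
def pullOp (I : B.EssIdeal) (a : OpField (fun t : I.beta => Fibre I t)) :
    OpField (fun s : B.Delta => DeltaFibre s) :=
  ⟨fun s => ((toLimit I s : Fibre I (s.proj I) →L[ℂ] DeltaFibre s) ∘L a (s.proj I)) ∘L
      ((toLimit I s).symm : DeltaFibre s →L[ℂ] Fibre I (s.proj I)),
    memℓp_infty ⟨‖a‖, by
      rintro _ ⟨s, rfl⟩
      refine ContinuousLinearMap.opNorm_le_bound _ (norm_nonneg _) fun x => ?_
      have h1 := (a (s.proj I)).le_opNorm ((toLimit I s).symm x)
      have h2 : ‖a (s.proj I)‖ ≤ ‖a‖ := lp.norm_apply_le_norm (by simp) a _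
      rw [LinearIsometryEquiv.norm_map] at h1
      have h3 := h1.trans (mul_le_mul_of_nonneg_right h2 (norm_nonneg x))
      simpa using h3⟩⟩

variable (B)

/-- `A_Δ`: the norm closure of the union of the algebras `{a ∘ Φ_I | a ∈ A^I}`. -/
def lowerA : Set (OpField (fun s : B.Delta => DeltaFibre s)) :=
  closure (⋃ I : B.EssIdeal, pullOp I '' fellAlgebra (OmegaI I))

/-- `A^Δ`: the Fell algebra of the direct limit bundle. -/
def upperA : Set (OpField (fun s : B.Delta => DeltaFibre s)) := fellAlgebra B.OmegaDelta

end ContinuousHilbertBundle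

end

/-!
Call an operator field *locally of almost finite rank* at a point if, near that point, it is
uniformly approximated by finite sums of fields `t ↦ ⟨·, ν(t)⟩ ω(t)` with `ω, ν` in the given space
of vector fields (`compactAt`). The sets of operator fields in the theorem are all described by
this condition.

* For every space of vector fields with continuous inner products, the Fell algebra consists of the
  bounded operator fields that are everywhere locally of almost finite rank and vanish at infinity
  (`ContinuousInner.mem_fellAlgebra_iff`). The Gram-Schmidt process, carried out on fields near a
  point, expresses the projections `p_s` by fields that are still approximable; conversely, it shows
  that a field of locally almost finite rank is close, near a point, to one with a constant
  matrix with respect to orthonormal fields, so that its norm is continuous. In particular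
  the Fell algebra of a bundle is an essential ideal of itself, and there are essential ideals.
* All fields `ω̄^I ∘ Φ_I` with `ω` bounded in `Ω` are independent of `I`, and `Ω^Δ` is the set of their
  local uniform limits (`mem_OmegaDelta_iff`). So `Ω^Δ` has continuous inner products, is closed
  under local uniform limits, and is dense in every fibre (`isHilbertBundle_OmegaDelta`).
* For such a module over a compact space, an adjointable operator `k` commutes with continuous
  functions, hence `‖(k ξ)(s)‖ ≤ ‖k‖ ‖ξ(s)‖`, and `k` is given by an operator field. This is the
  isometric `*`-homomorphism `opFieldHom`. The fields of locally almost finite rank act on the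
  module, so that the compact operators correspond to the uniform closure of the fields of finite
  rank (`image_compactOps`).
* `Δ` is compact and its topology is generated by the sets `Φ_I⁻¹(V)`. A partition of unity on a
  single `βX^I` therefore turns the local approximations of a field on `Δ` into a uniform one by
  an element of `A^I` which is also of finite rank over `Ω^Δ` (`exists_pullOp_close`). This makes
  `A_Δ`, `A^Δ` and the closure of the fields of finite rank all equal to the set of fields that are
  everywhere locally of almost finite rank.
-/

open Topology Filter
open scoped ENNReal BoundedContinuousFunction

noncomputable section

/-! ### Fields that are locally approximable at a point -/

section Approx

variable {T : Type*} [TopologicalSpace T] {G : T → Type*} [∀ t, NormedAddCommGroup (G t)]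
  [∀ t, NormedSpace ℂ (G t)]

/-- The fields that, near the point `t₀`, are uniformly approximated by fields in `E`. The fibres
are normed spaces, so that this covers vector fields as well as operator fields. -/
def approxAt (E : Submodule ℂ (∀ t, G t)) (t₀ : T) : Submodule ℂ (∀ t, G t) where
  carrier := {f | ∀ ε : ℝ, 0 < ε → ∃ e ∈ E, ∀ᶠ t in 𝓝 t₀, ‖e t - f t‖ < ε}
  zero_mem' := fun ε hε => ⟨0, zero_mem _, .of_forall fun t => by simpa using hε⟩
  add_mem' := by
    intro f g hf hg ε hε
    obtain ⟨d, hd, h1⟩ := hf (ε / 2) (half_pos hε)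
    obtain ⟨e, he, h2⟩ := hg (ε / 2) (half_pos hε)
    refine ⟨d + e, add_mem hd he, ?_⟩
    filter_upwards [h1, h2] with t h1 h2
    have : (d + e) t - (f + g) t = (d t - f t) + (e t - g t) := by
      simp only [Pi.add_apply]; abel
    rw [this]
    linarith [norm_add_le (d t - f t) (e t - g t)]
  smul_mem' := by
    intro c f hf ε hε
    have hc : (0 : ℝ) < ‖c‖ + 1 := by positivity
    obtain ⟨e, he, h1⟩ := hf (ε / (‖c‖ + 1)) (div_pos hε hc)
    refine ⟨c • e, E.smul_mem c he, ?_⟩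
    filter_upwards [h1] with t h1
    have : (c • e) t - (c • f) t = c • (e t - f t) := by simp [smul_sub]
    rw [this, norm_smul]
    rw [lt_div_iff₀ hc] at h1
    nlinarith [norm_nonneg (e t - f t), norm_nonneg c]

variable {E E' : Submodule ℂ (∀ t, G t)} {t₀ : T} {f g : ∀ t, G t}

lemma le_approxAt (E : Submodule ℂ (∀ t, G t)) (t₀ : T) : E ≤ approxAt E t₀ :=
  fun e he ε hε => ⟨e, he, .of_forall fun t => by simpa using hε⟩

/-- A field that is locally approximated by fields in `approxAt E t₀` is in `approxAt E t₀`. -/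
lemma mem_approxAt_of_forall
    (h : ∀ ε : ℝ, 0 < ε → ∃ e ∈ approxAt E t₀, ∀ᶠ t in 𝓝 t₀, ‖e t - f t‖ < ε) :
    f ∈ approxAt E t₀ := by
  intro ε hε
  obtain ⟨e, he, h1⟩ := h (ε / 2) (half_pos hε)
  obtain ⟨d, hd, h2⟩ := he (ε / 2) (half_pos hε)
  refine ⟨d, hd, ?_⟩
  filter_upwards [h1, h2] with t h1 h2
  linarith [norm_sub_le_norm_sub_add_norm_sub (d t) (e t) (f t)]

lemma approxAt_le (h : E ≤ approxAt E' t₀) : approxAt E t₀ ≤ approxAt E' t₀ := by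
  intro f hf
  refine mem_approxAt_of_forall fun ε hε => ?_
  obtain ⟨e, he, h1⟩ := hf ε hε
  exact ⟨e, h he, h1⟩

lemma mem_localUniformLimits_iff {H : T → Type*} [∀ t, NormedAddCommGroup (H t)]
    [∀ t, InnerProductSpace ℂ (H t)] {E : Submodule ℂ (∀ t, H t)} {f : ∀ t, H t} :
    f ∈ localUniformLimits E ↔ ∀ t₀, f ∈ approxAt E t₀ := by
  refine forall_congr' fun t₀ => forall_congr' fun ε => forall_congr' fun hε => ?_
  constructor
  · rintro ⟨U, hU, htU, e, he, h⟩
    exact ⟨e, he, Filter.mem_of_superset (hU.mem_nhds htU) h⟩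
  · rintro ⟨e, he, h⟩
    obtain ⟨U, hU, h1, h2⟩ := eventually_nhds_iff.1 h
    exact ⟨U, h1, h2, e, he, hU⟩

/-- The functions that are uniformly approximated near a point by functions continuous there are
continuous there. -/
lemma continuousAt_of_approx {M : Type*} [SeminormedAddCommGroup M] {f : T → M}
    (h : ∀ ε : ℝ, 0 < ε → ∃ g : T → M, ContinuousAt g t₀ ∧ ∀ᶠ t in 𝓝 t₀, ‖g t - f t‖ < ε) :
    ContinuousAt f t₀ := by
  refine continuousAt_of_locally_uniform_approx_of_continuousAt fun u hu => ?_
  obtain ⟨ε, hε, hu⟩ := Metric.mem_uniformity_dist.1 hu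
  obtain ⟨g, hg, h1⟩ := h ε hε
  refine ⟨_, h1, g, hg, fun y hy => hu ?_⟩
  rw [dist_comm, dist_eq_norm]
  exact hy

/-- The fields in `E` are bounded near every point. -/
def LocallyBoundedFields (E : Submodule ℂ (∀ t, G t)) : Prop :=
  ∀ e ∈ E, ∀ t₀, ∃ C : ℝ, ∀ᶠ t in 𝓝 t₀, ‖e t‖ ≤ C

lemma LocallyBoundedFields.exists_bound (hE : LocallyBoundedFields E) (hf : f ∈ approxAt E t₀) :
    ∃ C : ℝ, 0 < C ∧ ∀ᶠ t in 𝓝 t₀, ‖f t‖ ≤ C := by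
  obtain ⟨e, he, h⟩ := hf 1 one_pos
  obtain ⟨C, hC⟩ := hE e he t₀
  refine ⟨max C 0 + 1, by positivity, ?_⟩
  filter_upwards [h, hC] with t h hC
  have := norm_le_insert (e t) (f t)
  linarith [le_max_left C 0]

lemma LocallyBoundedFields.smul_mem (hE : LocallyBoundedFields E) {c : T → ℂ}
    (hc : ContinuousAt c t₀) (hf : f ∈ approxAt E t₀) :
    (fun t => c t • f t) ∈ approxAt E t₀ := by
  obtain ⟨C, hC0, hC⟩ := hE.exists_bound hf
  refine mem_approxAt_of_forall fun ε hε => ⟨c t₀ • f, Submodule.smul_mem _ _ hf, ?_⟩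
  have h1 : ∀ᶠ t in 𝓝 t₀, ‖c t - c t₀‖ < ε / C := by
    simpa [dist_eq_norm] using Metric.tendsto_nhds.1 hc (ε / C) (div_pos hε hC0)
  filter_upwards [hC, h1] with t hC h1
  rw [lt_div_iff₀ hC0] at h1
  rw [Pi.smul_apply, ← sub_smul, norm_smul, norm_sub_rev]
  exact (mul_le_mul_of_nonneg_left hC (norm_nonneg _)).trans_lt h1

end Approx

/-! ### Vector fields with continuous inner products -/

section VectorFields

variable {T : Type*} [TopologicalSpace T] {H : T → Type*} [∀ t, NormedAddCommGroup (H t)]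
  [∀ t, InnerProductSpace ℂ (H t)]

/-- All inner products of fields in `E` are continuous. -/
def ContinuousInner (E : Submodule ℂ (∀ t, H t)) : Prop :=
  ∀ ω ∈ E, ∀ ν ∈ E, Continuous fun t => inner ℂ (ω t) (ν t)

variable {E E' : Submodule ℂ (∀ t, H t)} {t₀ : T} {f g : ∀ t, H t}

lemma ContinuousInner.continuous_norm (hE : ContinuousInner E) (hf : f ∈ E) :
    Continuous fun t => ‖f t‖ := by
  simp only [@norm_eq_sqrt_re_inner ℂ]
  exact Real.continuous_sqrt.comp (RCLike.continuous_re.comp (hE f hf f hf))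

lemma ContinuousInner.locallyBounded (hE : ContinuousInner E) : LocallyBoundedFields E := by
  intro e he t₀
  refine ⟨‖e t₀‖ + 1, ?_⟩
  filter_upwards [(hE.continuous_norm he).continuousAt.eventually
    (gt_mem_nhds (lt_add_one ‖e t₀‖))] with t ht using ht.le

/-- A pairing is continuous at `t₀` if it is continuous for fields in `E` and is bounded by the
norms of the fields near `t₀`. -/
lemma ContinuousInner.continuousAt_sesq (hE : ContinuousInner E)
    {B : ∀ t, H t → H t → ℂ} {C : ℝ}
    (hC : ∀ t x y, ‖B t x y‖ ≤ C * ‖x‖ * ‖y‖)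
    (hl : ∀ t x x' y, B t (x - x') y = B t x y - B t x' y)
    (hr : ∀ t x y y', B t x (y - y') = B t x y - B t x y')
    (hB : ∀ ω ∈ E, ∀ ν ∈ E, ContinuousAt (fun t => B t (ω t) (ν t)) t₀)
    (hf : f ∈ approxAt E t₀) (hg : g ∈ approxAt E t₀) :
    ContinuousAt (fun t => B t (f t) (g t)) t₀ := by
  have hC' : ∀ t x y, ‖B t x y‖ ≤ |C| * ‖x‖ * ‖y‖ := fun t x y => (hC t x y).trans (by
    gcongr; exact le_abs_self C)
  have key : ∀ ω ∈ E, ContinuousAt (fun t => B t (ω t) (g t)) t₀ := by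
    intro ω hω
    obtain ⟨D, hD0, hD⟩ := hE.locallyBounded.exists_bound (le_approxAt E t₀ hω)
    refine continuousAt_of_approx fun ε hε => ?_
    have hp : 0 < (|C| + 1) * D := by positivity
    obtain ⟨e, he, h⟩ := hg (ε / ((|C| + 1) * D)) (div_pos hε hp)
    refine ⟨_, hB ω hω e he, ?_⟩
    filter_upwards [hD, h] with t hD h
    rw [← hr]
    rw [lt_div_iff₀ hp] at h
    refine (hC' _ _ _).trans_lt (lt_of_le_of_lt ?_ h)
    have : |C| * ‖ω t‖ ≤ (|C| + 1) * D := by gcongr; linarith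
    nlinarith [norm_nonneg (e t - g t)]
  obtain ⟨D, hD0, hD⟩ := hE.locallyBounded.exists_bound hg
  refine continuousAt_of_approx fun ε hε => ?_
  have hp : 0 < (|C| + 1) * D := by positivity
  obtain ⟨e, he, h⟩ := hf (ε / ((|C| + 1) * D)) (div_pos hε hp)
  refine ⟨_, key e he, ?_⟩
  filter_upwards [hD, h] with t hD h
  rw [← hl]
  rw [lt_div_iff₀ hp] at h
  refine (hC' _ _ _).trans_lt (lt_of_le_of_lt ?_ h)
  have : |C| * ‖g t‖ ≤ (|C| + 1) * D := by gcongr; linarith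
  nlinarith [norm_nonneg (e t - f t)]

lemma ContinuousInner.continuousAt_inner (hE : ContinuousInner E) (hf : f ∈ approxAt E t₀)
    (hg : g ∈ approxAt E t₀) : ContinuousAt (fun t => inner ℂ (f t) (g t)) t₀ :=
  hE.continuousAt_sesq (B := fun t x y => inner ℂ x y) (C := 1)
    (fun t x y => by simpa using norm_inner_le_norm x y) (fun t x x' y => inner_sub_left x x' y)
    (fun t x y y' => inner_sub_right x y y') (fun _ hω _ hν => (hE _ hω _ hν).continuousAt) hf hg

lemma ContinuousInner.continuousAt_norm (hE : ContinuousInner E) (hf : f ∈ approxAt E t₀) :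
    ContinuousAt (fun t => ‖f t‖) t₀ := by
  simp only [@norm_eq_sqrt_re_inner ℂ]
  exact Real.continuous_sqrt.continuousAt.comp
    (RCLike.continuous_re.continuousAt.comp (hE.continuousAt_inner hf hf))

lemma ContinuousInner.of_le (hE : ContinuousInner E) (h : ∀ t, E' ≤ approxAt E t) :
    ContinuousInner E' := fun _ hω _ hν => continuous_iff_continuousAt.2 fun t =>
  hE.continuousAt_inner (h t hω) (h t hν)

/-- Approximable fields that agree at `t₀` are close to each other near `t₀`. -/
lemma ContinuousInner.tendsto_norm_sub (hE : ContinuousInner E)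
    (hf : f ∈ approxAt E t₀) (hg : g ∈ approxAt E t₀) (h : f t₀ = g t₀) :
    Tendsto (fun t => ‖f t - g t‖) (𝓝 t₀) (𝓝 0) := by
  have := (hE.continuousAt_norm (sub_mem hf hg)).tendsto
  simpa [h] using this

/-! ### Gram-Schmidt orthonormalization of fields -/

lemma ContinuousInner.gramSchmidt_mem (hE : ContinuousInner E) {n : ℕ} {ω : Fin n → ∀ t, H t}
    (hω : ∀ i, ω i ∈ approxAt E t₀) (hli : LinearIndependent ℂ fun i => ω i t₀) (j : Fin n) :
    (fun t => InnerProductSpace.gramSchmidt ℂ (fun i => ω i t) j) ∈ approxAt E t₀ := by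
  induction j using WellFoundedLT.induction with
  | ind j ih =>
    have : (fun t => InnerProductSpace.gramSchmidt ℂ (fun i => ω i t) j) = ω j -
        ∑ i ∈ Finset.Iio j, fun t => (inner ℂ (InnerProductSpace.gramSchmidt ℂ (fun i => ω i t) i)
          (ω j t) / (‖InnerProductSpace.gramSchmidt ℂ (fun i => ω i t) i‖ ^ 2 : ℝ) : ℂ) •
            InnerProductSpace.gramSchmidt ℂ (fun i => ω i t) i := by
      funext t
      rw [InnerProductSpace.gramSchmidt_def]
      simp [Submodule.starProjection_singleton]
    rw [this]
    refine sub_mem (hω j) (sum_mem fun i hi => ?_)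
    have hi' := ih i (Finset.mem_Iio.1 hi)
    refine hE.locallyBounded.smul_mem (ContinuousAt.div (hE.continuousAt_inner hi' (hω j))
      (Complex.continuous_ofReal.continuousAt.comp ((hE.continuousAt_norm hi').pow 2)) ?_) hi'
    have := InnerProductSpace.gramSchmidt_ne_zero (𝕜 := ℂ) i hli
    simpa using this

/-- Near `t₀`, the Gram-Schmidt process turns fields that are linearly independent at `t₀` into
orthonormal fields; in particular the given fields are linearly independent near `t₀`. -/
lemma ContinuousInner.gramSchmidtNormed_mem (hE : ContinuousInner E) {n : ℕ}
    {ω : Fin n → ∀ t, H t}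
    (hω : ∀ i, ω i ∈ approxAt E t₀) (hli : LinearIndependent ℂ fun i => ω i t₀) :
    (∀ j, (fun t => InnerProductSpace.gramSchmidtNormed ℂ (fun i => ω i t) j) ∈ approxAt E t₀) ∧
    (∀ᶠ t in 𝓝 t₀, LinearIndependent ℂ fun i => ω i t) := by
  have h0 := fun j => hE.gramSchmidt_mem hω hli j
  have hne := fun j => InnerProductSpace.gramSchmidt_ne_zero (𝕜 := ℂ) j hli
  constructor
  · intro j
    refine hE.locallyBounded.smul_mem ?_ (h0 j)
    refine ContinuousAt.inv₀ (Complex.continuous_ofReal.continuousAt.comp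
      (hE.continuousAt_norm (h0 j))) ?_
    simpa using hne j
  · have : ∀ᶠ t in 𝓝 t₀, ∀ j, ‖InnerProductSpace.gramSchmidt ℂ (fun i => ω i t) j‖ ≠ 0 :=
      eventually_all.2 fun j => (hE.continuousAt_norm (h0 j)).eventually_ne (by simpa using hne j)
    filter_upwards [this] with t ht
    rw [linearIndependent_iff_card_eq_finrank_span, Set.finrank,
      ← InnerProductSpace.span_gramSchmidt]
    exact linearIndependent_iff_card_eq_finrank_span.1
      (linearIndependent_of_ne_zero_of_inner_eq_zero (fun j => norm_ne_zero_iff.1 (ht j))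
      (fun i j hij => InnerProductSpace.gramSchmidt_orthogonal ℂ _ hij))

end VectorFields

/-! ### Operator fields of locally finite rank -/

section OperatorFields

open InnerProductSpace

variable {T : Type*} {H : T → Type*} [∀ t, NormedAddCommGroup (H t)]
  [∀ t, InnerProductSpace ℂ (H t)]

/-- The subspaces of the space of all operator fields. The vector space structure is spelled as the
one that underlies the operator norm, which is the form expected by `approxAt`. -/
abbrev OperatorFieldSubmodule (H : T → Type*) [∀ t, NormedAddCommGroup (H t)]
    [∀ t, InnerProductSpace ℂ (H t)] : Type _ :=
  @Submodule ℂ (∀ t, H t →L[ℂ] H t) _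
    (@AddCommGroup.toAddCommMonoid _ (@Pi.addCommGroup T (fun t => H t →L[ℂ] H t)
      fun _ => ContinuousLinearMap.toNormedAddCommGroup.toAddCommGroup)) _

/-- The finite sums of the operator fields `t ↦ ⟨·, ν(t)⟩ ω(t)` with `ω, ν ∈ E`. -/
def rankOneFields (E : Submodule ℂ (∀ t, H t)) : OperatorFieldSubmodule H :=
  Submodule.span ℂ {a | ∃ ω ∈ E, ∃ ν ∈ E, a = fun t => rankOne ℂ (ω t) (ν t)}

lemma rankOne_mem_rankOneFields {E : Submodule ℂ (∀ t, H t)} {ω ν : ∀ t, H t} (hω : ω ∈ E)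
    (hν : ν ∈ E) : (fun t => rankOne ℂ (ω t) (ν t)) ∈ rankOneFields E :=
  Submodule.subset_span ⟨ω, hω, ν, hν, rfl⟩

lemma rankOneFields_induction {E : Submodule ℂ (∀ t, H t)}
    {N : OperatorFieldSubmodule H}
    (h : ∀ ω ∈ E, ∀ ν ∈ E, (fun t => rankOne ℂ (ω t) (ν t)) ∈ N) : rankOneFields E ≤ N :=
  Submodule.span_le.2 fun _ ⟨ω, hω, ν, hν, e⟩ => e ▸ h ω hω ν hν

lemma rankOneFields_mono {E E' : Submodule ℂ (∀ t, H t)} (h : E ≤ E') :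
    rankOneFields E ≤ rankOneFields E' :=
  rankOneFields_induction fun _ hω _ hν => rankOne_mem_rankOneFields (h hω) (h hν)

lemma norm_rankOne_sub_rankOne_le {K : Type*} [NormedAddCommGroup K] [InnerProductSpace ℂ K]
    (x x' y y' : K) :
    ‖rankOne ℂ x y - rankOne ℂ x' y'‖ ≤ ‖x - x'‖ * ‖y‖ + ‖x'‖ * ‖y - y'‖ := by
  have : rankOne ℂ x y - rankOne ℂ x' y' = rankOne ℂ (x - x') y + rankOne ℂ x' (y - y') := by
    simp
  rw [this, ← norm_rankOne (𝕜 := ℂ), ← norm_rankOne (𝕜 := ℂ)]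
  exact norm_add_le _ _

/-- The operator with matrix `m` with respect to an orthonormal family has a norm that depends
only on `m`. -/
lemma norm_sum_smul_rankOne_orthonormal {K : Type*} [NormedAddCommGroup K] [InnerProductSpace ℂ K]
    [CompleteSpace K] {n : ℕ} (m : Fin n × Fin n → ℂ) {f : Fin n → K} (hf : Orthonormal ℂ f) :
    ‖∑ p, m p • rankOne ℂ (f p.1) (f p.2)‖ =
      ‖∑ p : Fin n × Fin n, m p • rankOne ℂ (EuclideanSpace.basisFun (Fin n) ℂ p.1)
        (EuclideanSpace.basisFun (Fin n) ℂ p.2)‖ := by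
  let b := EuclideanSpace.basisFun (Fin n) ℂ
  have hb : ((b.toBasis.constr ℂ f : EuclideanSpace ℂ (Fin n) →ₗ[ℂ] K) ∘ b.toBasis) = f := by
    funext i
    simp only [Function.comp_apply, Module.Basis.constr_basis]
  let V : EuclideanSpace ℂ (Fin n) →ₗᵢ[ℂ] K :=
    (b.toBasis.constr ℂ f).isometryOfOrthonormal (v := b.toBasis)
      (by rw [b.coe_toBasis]; exact b.orthonormal) (by rw [hb]; exact hf)
  have hV : ∀ i, V (b i) = f i := fun i => by
    have := congrFun hb i
    rw [b.coe_toBasis] at this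
    exact this
  let A := ∑ p : Fin n × Fin n, m p • rankOne ℂ (b p.1) (b p.2)
  have h1 : ∑ p, m p • rankOne ℂ (f p.1) (f p.2) =
      V.toContinuousLinearMap ∘L (A ∘L ContinuousLinearMap.adjoint V.toContinuousLinearMap) := by
    simp only [A, ContinuousLinearMap.finsetSum_comp, ContinuousLinearMap.comp_finsetSum,
      ContinuousLinearMap.smul_comp, ContinuousLinearMap.comp_smul, rankOne_comp, comp_rankOne,
      ContinuousLinearMap.adjoint_adjoint, LinearIsometry.coe_toContinuousLinearMap, hV]
  have h2 : ∀ A : EuclideanSpace ℂ (Fin n) →L[ℂ] EuclideanSpace ℂ (Fin n),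
      ‖A ∘L ContinuousLinearMap.adjoint V.toContinuousLinearMap‖ = ‖A‖ := fun A => by
    rw [← LinearIsometryEquiv.norm_map ContinuousLinearMap.adjoint, ContinuousLinearMap.adjoint_comp,
      ContinuousLinearMap.adjoint_adjoint, LinearIsometry.norm_toContinuousLinearMap_comp,
      LinearIsometryEquiv.norm_map]
  rw [h1, LinearIsometry.norm_toContinuousLinearMap_comp, h2]

lemma spanProj_apply_of_mem {K : Type*} [NormedAddCommGroup K] [InnerProductSpace ℂ K] {n : ℕ}
    {v : Fin n → K} {x : K} (hx : x ∈ Submodule.span ℂ (Set.range v)) : spanProj v x = x := by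
  have : FiniteDimensional ℂ (Submodule.span ℂ (Set.range v)) :=
    FiniteDimensional.span_of_finite ℂ (Set.finite_range v)
  exact Submodule.starProjection_eq_self_iff.2 hx

lemma norm_spanProj_le {K : Type*} [NormedAddCommGroup K] [InnerProductSpace ℂ K] {n : ℕ}
    (v : Fin n → K) : ‖spanProj v‖ ≤ 1 := by
  have : FiniteDimensional ℂ (Submodule.span ℂ (Set.range v)) :=
    FiniteDimensional.span_of_finite ℂ (Set.finite_range v)
  exact Submodule.starProjection_norm_le _

lemma adjoint_spanProj {K : Type*} [NormedAddCommGroup K] [InnerProductSpace ℂ K] [CompleteSpace K]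
    {n : ℕ} (v : Fin n → K) : ContinuousLinearMap.adjoint (spanProj v) = spanProj v := by
  have : FiniteDimensional ℂ (Submodule.span ℂ (Set.range v)) :=
    FiniteDimensional.span_of_finite ℂ (Set.finite_range v)
  exact (isSelfAdjoint_starProjection (Submodule.span ℂ (Set.range v)))

/-- The projection onto the span of linearly independent vectors, in terms of their Gram-Schmidt
orthonormalization. -/
lemma spanProj_eq_sum {K : Type*} [NormedAddCommGroup K] [InnerProductSpace ℂ K]
    {n : ℕ} {v : Fin n → K} (hv : LinearIndependent ℂ v) :
    spanProj v = ∑ j, rankOne ℂ (gramSchmidtNormed ℂ v j) (gramSchmidtNormed ℂ v j) := by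
  have : FiniteDimensional ℂ (Submodule.span ℂ (Set.range v)) :=
    FiniteDimensional.span_of_finite ℂ (Set.finite_range v)
  have ho := gramSchmidtNormed_orthonormal (𝕜 := ℂ) hv
  have hs : Submodule.span ℂ (Set.range (gramSchmidtNormed ℂ v)) =
      Submodule.span ℂ (Set.range v) := by
    rw [span_gramSchmidtNormed_range, span_gramSchmidt]
  ext x
  refine Submodule.eq_starProjection_of_mem_of_inner_eq_zero ?_ ?_
  · rw [← hs, _root_.sum_apply]
    exact sum_mem fun j _ => Submodule.smul_mem _ _ (Submodule.subset_span ⟨j, rfl⟩)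
  · intro w hw
    rw [← hs] at hw
    induction hw using Submodule.span_induction with
    | mem w hw =>
      obtain ⟨i, rfl⟩ := hw
      simp only [_root_.sum_apply, rankOne_apply, inner_sub_left, sum_inner,
        inner_smul_left, orthonormal_iff_ite.1 ho, inner_conj_symm]
      simp
    | zero => simp
    | add w w' _ _ h h' => rw [inner_add_right, h, h', add_zero]
    | smul c w _ h => rw [inner_smul_right, h, mul_zero]

/-- Finitely many vectors of the form `ω(t₀)` with `ω ∈ E` lie in the span of an orthonormal family
of such vectors. -/
lemma exists_orthonormal_fields {E : Submodule ℂ (∀ t, H t)} {ι : Type*} [Finite ι]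
    {ω : ι → ∀ t, H t} (hω : ∀ i, ω i ∈ E)
    (t₀ : T) : ∃ (n : ℕ) (e : Fin n → ∀ t, H t), (∀ j, e j ∈ E) ∧
      (Orthonormal ℂ fun j => e j t₀) ∧
      ∀ i, ω i t₀ ∈ Submodule.span ℂ (Set.range fun j => e j t₀) := by
  set M := Submodule.span ℂ (Set.range fun i => ω i t₀)
  have : FiniteDimensional ℂ M := FiniteDimensional.span_of_finite ℂ (Set.finite_range _)
  let b := stdOrthonormalBasis ℂ M
  have hM : M ≤ E.map (LinearMap.proj t₀) := Submodule.span_le.2 (by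
    rintro _ ⟨i, rfl⟩; exact ⟨ω i, hω i, rfl⟩)
  choose e he hb using fun j => hM (b j).2
  have hb' : (fun j => e j t₀) = fun j => (b j : H t₀) := funext hb
  refine ⟨_, e, he, ?_, fun i => ?_⟩
  · rw [hb']
    exact b.orthonormal.comp_linearIsometry M.subtypeₗᵢ
  · have h1 : ω i t₀ ∈ M := Submodule.subset_span ⟨i, rfl⟩
    rw [hb']
    have h2 := b.sum_repr ⟨ω i t₀, h1⟩
    have h3 := congrArg (M.subtype) h2
    rw [map_sum] at h3
    have h4 : ω i t₀ = ∑ j, b.repr ⟨ω i t₀, h1⟩ j • (b j : H t₀) := by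
      simpa using h3.symm
    rw [h4]
    exact sum_mem fun j _ => Submodule.smul_mem _ _ (Submodule.subset_span ⟨j, rfl⟩)

/-- The operator fields that, near `t₀`, are uniformly approximated by fields of finite rank. -/
def compactAt [TopologicalSpace T] (E : Submodule ℂ (∀ t, H t)) (t₀ : T) :
    OperatorFieldSubmodule H :=
  approxAt (G := fun t => H t →L[ℂ] H t) (rankOneFields E) t₀

variable [TopologicalSpace T] {E E' : Submodule ℂ (∀ t, H t)} {t₀ : T} {f f' g g' : ∀ t, H t}
  {a b : ∀ t, H t →L[ℂ] H t}

namespace ContinuousInner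

lemma rankOneFields_locallyBounded (hE : ContinuousInner E) :
    LocallyBoundedFields (G := fun t => H t →L[ℂ] H t) (rankOneFields E) := by
  intro a ha t₀
  induction ha using Submodule.span_induction with
  | mem a ha =>
    obtain ⟨ω, hω, ν, hν, rfl⟩ := ha
    obtain ⟨C, hC⟩ := hE.locallyBounded ω hω t₀
    obtain ⟨D, hD⟩ := hE.locallyBounded ν hν t₀
    refine ⟨C * D, ?_⟩
    filter_upwards [hC, hD] with t hC hD
    rw [norm_rankOne]
    gcongr
    exact (norm_nonneg _).trans hC
  | zero => exact ⟨0, .of_forall fun t => by simp⟩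
  | add a b _ _ ha hb =>
    obtain ⟨C, hC⟩ := ha
    obtain ⟨D, hD⟩ := hb
    refine ⟨C + D, ?_⟩
    filter_upwards [hC, hD] with t hC hD
    exact (norm_add_le _ _).trans (add_le_add hC hD)
  | smul c a _ ha =>
    obtain ⟨C, hC⟩ := ha
    refine ⟨‖c‖ * C, ?_⟩
    filter_upwards [hC] with t hC
    rw [Pi.smul_apply, norm_smul]
    gcongr

lemma rankOne_mem (hE : ContinuousInner E) (hf : f ∈ approxAt E t₀) (hg : g ∈ approxAt E t₀) :
    (fun t => rankOne ℂ (f t) (g t)) ∈ compactAt E t₀ := by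
  obtain ⟨D, hD0, hD⟩ := hE.locallyBounded.exists_bound hg
  intro ε hε
  obtain ⟨e, he, h1⟩ := hf (ε / (2 * D)) (by positivity)
  obtain ⟨C, hC0, hC⟩ := hE.locallyBounded.exists_bound (le_approxAt E t₀ he)
  obtain ⟨e', he', h2⟩ := hg (ε / (2 * C)) (by positivity)
  refine ⟨_, rankOne_mem_rankOneFields he he', ?_⟩
  filter_upwards [hD, h1, hC, h2] with t hD h1 hC h2
  rw [norm_sub_rev]
  refine (norm_rankOne_sub_rankOne_le _ _ _ _).trans_lt ?_
  rw [norm_sub_rev (f t), norm_sub_rev (g t)]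
  have e1 : ‖e t - f t‖ * ‖g t‖ ≤ ε / (2 * D) * D := by gcongr
  have e2 : ‖e t‖ * ‖e' t - g t‖ < C * (ε / (2 * C)) :=
    (mul_le_mul_of_nonneg_right hC (norm_nonneg _)).trans_lt (mul_lt_mul_of_pos_left h2 hC0)
  have e3 : ε / (2 * D) * D = ε / 2 := by field_simp
  have e4 : C * (ε / (2 * C)) = ε / 2 := by field_simp
  linarith

lemma rankOneFields_le (hE : ContinuousInner E) (h : E' ≤ approxAt E t₀) :
    rankOneFields E' ≤ compactAt E t₀ :=
  rankOneFields_induction fun _ hω _ hν => hE.rankOne_mem (h hω) (h hν)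

lemma compactAt_le (hE : ContinuousInner E) (h : E' ≤ approxAt E t₀) :
    compactAt E' t₀ ≤ compactAt E t₀ :=
  approxAt_le (G := fun t => H t →L[ℂ] H t) (hE.rankOneFields_le h)

lemma apply_mem (hE : ContinuousInner E) (ha : a ∈ compactAt E t₀)
    (hf : f ∈ approxAt E t₀) : (fun t => a t (f t)) ∈ approxAt E t₀ := by
  obtain ⟨C, hC0, hC⟩ := hE.locallyBounded.exists_bound hf
  refine mem_approxAt_of_forall fun ε hε => ?_
  obtain ⟨F, hF, h⟩ := ha (ε / C) (by positivity)
  refine ⟨fun t => F t (f t), ?_, ?_⟩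
  · let L : (∀ t, H t →L[ℂ] H t) →ₗ[ℂ] ∀ t, H t :=
      { toFun := fun a t => a t (f t), map_add' := fun _ _ => rfl, map_smul' := fun _ _ => rfl }
    have : rankOneFields E ≤ (approxAt E t₀).comap L := rankOneFields_induction
      fun ω hω ν hν => hE.locallyBounded.smul_mem
        (hE.continuousAt_inner (le_approxAt E t₀ hν) hf) (le_approxAt E t₀ hω)
    exact this hF
  · filter_upwards [hC, h] with t hC h
    rw [lt_div_iff₀ hC0] at h
    rw [← _root_.sub_apply]
    exact ((F t - a t).le_opNorm _).trans_lt (lt_of_le_of_lt (by gcongr) h)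

lemma adjoint_mem [∀ t, CompleteSpace (H t)] (ha : a ∈ compactAt E t₀) :
    (fun t => ContinuousLinearMap.adjoint (a t)) ∈ compactAt E t₀ := by
  intro ε hε
  obtain ⟨F, hF, h⟩ := ha ε hε
  refine ⟨fun t => ContinuousLinearMap.adjoint (F t), ?_, ?_⟩
  · clear h
    induction hF using Submodule.span_induction with
    | mem F hF =>
      obtain ⟨ω, hω, ν, hν, rfl⟩ := hF
      simpa only [adjoint_rankOne] using rankOne_mem_rankOneFields hν hω
    | zero =>
      rw [show (fun t => ContinuousLinearMap.adjoint ((0 : ∀ t, H t →L[ℂ] H t) t)) = 0 from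
        funext fun t => map_zero _]
      exact zero_mem (rankOneFields E)
    | add F F' _ _ h h' =>
      rw [show (fun t => ContinuousLinearMap.adjoint ((F + F') t)) =
        (fun t => ContinuousLinearMap.adjoint (F t)) + fun t => ContinuousLinearMap.adjoint (F' t)
        from funext fun t => map_add _ _ _]
      exact add_mem h h'
    | smul c F _ h =>
      rw [show (fun t => ContinuousLinearMap.adjoint ((c • F) t)) =
        (starRingEnd ℂ) c • fun t => ContinuousLinearMap.adjoint (F t)
        from funext fun t => by rw [Pi.smul_apply, map_smulₛₗ, Pi.smul_apply]]
      exact (rankOneFields E).smul_mem ((starRingEnd ℂ) c) h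
  · filter_upwards [h] with t h
    rwa [← map_sub, LinearIsometryEquiv.norm_map]

/-- A product `a b` is approximated by products `F b` with `F` of finite rank, and `F b` is built
from the fields `ω` and `b* ν` if `F` is built from the fields `ω` and `ν`. -/
lemma comp_mem [∀ t, CompleteSpace (H t)] (hE : ContinuousInner E)
    (ha : a ∈ compactAt E t₀) (hb : b ∈ compactAt E t₀) :
    (fun t => a t ∘L b t) ∈ compactAt E t₀ := by
  obtain ⟨C, hC0, hC⟩ := hE.rankOneFields_locallyBounded.exists_bound hb
  refine mem_approxAt_of_forall fun ε hε => ?_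
  obtain ⟨F, hF, h⟩ := ha (ε / C) (by positivity)
  refine ⟨fun t => F t ∘L b t, ?_, ?_⟩
  · clear h
    change _ ∈ compactAt E t₀
    induction hF using Submodule.span_induction with
    | mem F hF =>
      obtain ⟨ω, hω, ν, hν, rfl⟩ := hF
      simp only [rankOne_comp]
      exact hE.rankOne_mem (le_approxAt E t₀ hω) (hE.apply_mem (adjoint_mem hb) (le_approxAt E t₀ hν))
    | zero =>
      rw [show (fun t => (0 : ∀ t, H t →L[ℂ] H t) t ∘L b t) = 0 from
        funext fun t => ContinuousLinearMap.zero_comp _]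
      exact zero_mem (compactAt E t₀)
    | add F F' _ _ h h' =>
      rw [show (fun t => (F + F') t ∘L b t) = (fun t => F t ∘L b t) + fun t => F' t ∘L b t from
        funext fun t => ContinuousLinearMap.add_comp _ _ _]
      exact add_mem h h'
    | smul c F _ h =>
      rw [show (fun t => (c • F) t ∘L b t) = c • fun t => F t ∘L b t from
        funext fun t => ContinuousLinearMap.smul_comp _ _ _]
      exact (compactAt E t₀).smul_mem c h
  · filter_upwards [hC, h] with t hC h
    rw [lt_div_iff₀ hC0] at h
    rw [← ContinuousLinearMap.sub_comp]
    exact (ContinuousLinearMap.opNorm_comp_le _ _).trans_lt (lt_of_le_of_lt (by gcongr) h)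

lemma tendsto_norm_rankOne_sub (hE : ContinuousInner E) (hf : f ∈ approxAt E t₀)
    (hf' : f' ∈ approxAt E t₀) (hg : g ∈ approxAt E t₀) (hg' : g' ∈ approxAt E t₀)
    (h : f t₀ = f' t₀) (h' : g t₀ = g' t₀) :
    Tendsto (fun t => ‖rankOne ℂ (f t) (g t) - rankOne ℂ (f' t) (g' t)‖) (𝓝 t₀) (𝓝 0) := by
  refine squeeze_zero (fun _ => norm_nonneg _) (fun t => norm_rankOne_sub_rankOne_le _ _ _ _) ?_
  have h1 := (hE.tendsto_norm_sub hf hf' h).mul (hE.continuousAt_norm hg).tendsto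
  have h2 := (hE.continuousAt_norm hf').tendsto.mul (hE.tendsto_norm_sub hg hg' h')
  simpa using h1.add h2

/-- Near a point, an operator field that is approximable by fields of finite rank is close to a
field with constant coefficients with respect to vector fields that are orthonormal at the point. -/
lemma exists_constant_coeff (hE : ContinuousInner E) (ha : a ∈ compactAt E t₀)
    {ε : ℝ} (hε : 0 < ε) : ∃ (n : ℕ) (e : Fin n → ∀ t, H t) (m : Fin n × Fin n → ℂ),
      (∀ j, e j ∈ E) ∧ (Orthonormal ℂ fun j => e j t₀) ∧
      ∀ᶠ t in 𝓝 t₀, ‖(∑ p, m p • rankOne ℂ (e p.1 t) (e p.2 t)) - a t‖ < ε := by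
  obtain ⟨F, hF, h⟩ := ha (ε / 2) (half_pos hε)
  obtain ⟨N, c, r, rfl⟩ := Submodule.mem_span_set'.1 hF
  choose ω hω ν hν hr using fun i => (r i).2
  obtain ⟨n, e, he, ho, hs⟩ := exists_orthonormal_fields (ω := Sum.elim ω ν)
    (by rintro (i | i); exacts [hω i, hν i]) t₀
  choose α hα using fun i => (Submodule.mem_span_range_iff_exists_fun ℂ).1 (hs (.inl i))
  choose β hβ using fun i => (Submodule.mem_span_range_iff_exists_fun ℂ).1 (hs (.inr i))
  refine ⟨n, e, fun p => ∑ i, c i * α i p.1 * (starRingEnd ℂ) (β i p.2), he, ho, ?_⟩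
  have hmem : ∀ γ : Fin n → ℂ, (fun t => ∑ j, γ j • e j t) ∈ E := fun γ => by
    have : (fun t => ∑ j, γ j • e j t) = ∑ j, γ j • e j := by
      funext t; simp
    rw [this]
    exact sum_mem fun j _ => E.smul_mem _ (he j)
  have hsum : ∀ t, (∑ p : Fin n × Fin n, (∑ i, c i * α i p.1 * (starRingEnd ℂ) (β i p.2)) •
      rankOne ℂ (e p.1 t) (e p.2 t)) =
      ∑ i, c i • rankOne ℂ (∑ j, α i j • e j t) (∑ j, β i j • e j t) := by
    intro t
    simp only [Finset.sum_smul, map_sum, _root_.sum_apply, map_smul, map_smulₛₗ,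
      _root_.smul_apply, Finset.smul_sum, smul_smul]
    rw [Finset.sum_comm]
    refine Finset.sum_congr rfl fun i _ => ?_
    rw [Fintype.sum_prod_type, Finset.sum_comm]
    refine Finset.sum_congr rfl fun j _ => Finset.sum_congr rfl fun k _ => ?_
    congr 1
    ring
  have hlim : Tendsto (fun t => ∑ i, ‖c i‖ * ‖rankOne ℂ (∑ j, α i j • e j t) (∑ j, β i j • e j t) -
      rankOne ℂ (ω i t) (ν i t)‖) (𝓝 t₀) (𝓝 0) := by
    have : ∀ i, Tendsto (fun t => ‖c i‖ * ‖rankOne ℂ (∑ j, α i j • e j t) (∑ j, β i j • e j t) -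
        rankOne ℂ (ω i t) (ν i t)‖) (𝓝 t₀) (𝓝 0) := fun i => mul_zero ‖c i‖ ▸
      (hE.tendsto_norm_rankOne_sub (le_approxAt E t₀ (hmem _)) (le_approxAt E t₀ (hω i))
        (le_approxAt E t₀ (hmem _)) (le_approxAt E t₀ (hν i)) (hα i) (hβ i)).const_mul _
    simpa only [Finset.sum_const_zero] using tendsto_finsetSum Finset.univ fun i _ => this i
  filter_upwards [h, hlim.eventually (gt_mem_nhds (half_pos hε))] with t h1 h2
  rw [hsum t]
  refine (norm_sub_le_norm_sub_add_norm_sub _ ((∑ i, c i • (r i : ∀ t, H t →L[ℂ] H t)) t) _).trans_lt ?_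
  have h3 : ‖∑ i, c i • rankOne ℂ (∑ j, α i j • e j t) (∑ j, β i j • e j t) -
      (∑ i, c i • (r i : ∀ t, H t →L[ℂ] H t)) t‖ ≤ ∑ i, ‖c i‖ *
        ‖rankOne ℂ (∑ j, α i j • e j t) (∑ j, β i j • e j t) - rankOne ℂ (ω i t) (ν i t)‖ := by
    rw [Finset.sum_apply, ← Finset.sum_sub_distrib]
    refine (norm_sum_le _ _).trans (Finset.sum_le_sum fun i _ => ?_)
    rw [Pi.smul_apply, hr i, ← smul_sub, norm_smul]
  linarith

variable [∀ t, CompleteSpace (H t)]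

/-- The norm of a field that is locally of almost finite rank is continuous: the field is close to
one whose matrix with respect to orthonormal fields is constant, and the norm of the latter is
constant. -/
lemma continuousAt_opNorm (hE : ContinuousInner E) (ha : a ∈ compactAt E t₀) :
    ContinuousAt (fun t => ‖a t‖) t₀ := by
  refine continuousAt_of_approx fun ε hε => ?_
  obtain ⟨n, e, m, he, ho, h⟩ := hE.exists_constant_coeff ha (half_pos hε)
  obtain ⟨h1, h2⟩ := hE.gramSchmidtNormed_mem (fun j => le_approxAt E t₀ (he j)) ho.linearIndependent
  -- At `t₀` itself, the Gram-Schmidt process does not change the fields.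
  have h0 : ∀ j, gramSchmidtNormed ℂ (fun i => e i t₀) j = e j t₀ := fun j => by
    rw [InnerProductSpace.gramSchmidtNormed, gramSchmidt_of_orthogonal ℂ ho.2, ho.1 j]
    simp
  have hlim : Tendsto (fun t => ∑ p : Fin n × Fin n, ‖m p‖ * ‖rankOne ℂ
      (gramSchmidtNormed ℂ (fun i => e i t) p.1) (gramSchmidtNormed ℂ (fun i => e i t) p.2) -
      rankOne ℂ (e p.1 t) (e p.2 t)‖) (𝓝 t₀) (𝓝 0) := by
    have : ∀ p : Fin n × Fin n, Tendsto (fun t => ‖m p‖ * ‖rankOne ℂ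
        (gramSchmidtNormed ℂ (fun i => e i t) p.1) (gramSchmidtNormed ℂ (fun i => e i t) p.2) -
        rankOne ℂ (e p.1 t) (e p.2 t)‖) (𝓝 t₀) (𝓝 0) := fun p => mul_zero ‖m p‖ ▸
      (hE.tendsto_norm_rankOne_sub (h1 p.1) (le_approxAt E t₀ (he _))
        (h1 p.2) (le_approxAt E t₀ (he _)) (h0 p.1) (h0 p.2)).const_mul _
    simpa only [Finset.sum_const_zero] using tendsto_finsetSum Finset.univ fun i _ => this i
  refine ⟨fun _ => ‖∑ p : Fin n × Fin n, m p • rankOne ℂ (EuclideanSpace.basisFun (Fin n) ℂ p.1)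
        (EuclideanSpace.basisFun (Fin n) ℂ p.2)‖, continuousAt_const, ?_⟩
  filter_upwards [h, h2, hlim.eventually (gt_mem_nhds (half_pos hε))] with t h h2 h3
  rw [← norm_sum_smul_rankOne_orthonormal m (gramSchmidtNormed_orthonormal (𝕜 := ℂ) h2)]
  refine (abs_norm_sub_norm_le _ _).trans_lt ?_
  refine (norm_sub_le_norm_sub_add_norm_sub _
    (∑ p, m p • rankOne ℂ (e p.1 t) (e p.2 t)) _).trans_lt ?_
  have h4 : ‖(∑ p, m p • rankOne ℂ
      (gramSchmidtNormed ℂ (fun i => e i t) p.1) (gramSchmidtNormed ℂ (fun i => e i t) p.2)) -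
      ∑ p, m p • rankOne ℂ (e p.1 t) (e p.2 t)‖ ≤ ∑ p : Fin n × Fin n, ‖m p‖ * ‖rankOne ℂ
      (gramSchmidtNormed ℂ (fun i => e i t) p.1) (gramSchmidtNormed ℂ (fun i => e i t) p.2) -
      rankOne ℂ (e p.1 t) (e p.2 t)‖ := by
    rw [← Finset.sum_sub_distrib]
    refine (norm_sum_le _ _).trans (Finset.sum_le_sum fun i _ => ?_)
    rw [← smul_sub, norm_smul]
  linarith

/-- The Fell algebra consists of the bounded operator fields that are locally approximable by
fields of finite rank and vanish at infinity. -/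
theorem mem_fellAlgebra_iff (hE : ContinuousInner E) {a : OpField H} :
    a ∈ fellAlgebra E ↔ (∀ t, (fun t => a t) ∈ compactAt E t) ∧
      Tendsto (fun t => ‖a t‖) (cocompact T) (𝓝 0) := by
  constructor
  · rintro ⟨hw, hfd, -, h0⟩
    -- In terms of the orthonormalized fields, `p a p` has coefficients that are continuous at `t₀`.
    refine ⟨fun t₀ => mem_approxAt_of_forall fun ε hε => ?_, h0⟩
    obtain ⟨U, hU, htU, n, ω, hω, h⟩ := hfd t₀ ε hε
    have h1 := (hE.gramSchmidtNormed_mem (fun j => le_approxAt E t₀ (hω j)) (h t₀ htU).1).1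
    refine ⟨∑ j, ∑ k, fun t => inner ℂ (gramSchmidtNormed ℂ (fun i => ω i t) j)
      (a t (gramSchmidtNormed ℂ (fun i => ω i t) k)) •
      rankOne ℂ (gramSchmidtNormed ℂ (fun i => ω i t) j) (gramSchmidtNormed ℂ (fun i => ω i t) k),
      sum_mem fun j _ => sum_mem fun k _ => hE.rankOneFields_locallyBounded.smul_mem ?_
        (hE.rankOne_mem (h1 j) (h1 k)), ?_⟩
    · refine hE.continuousAt_sesq (B := fun t x y => inner ℂ x (a t y)) (C := ‖a‖) ?_ ?_ ?_ ?_
        (h1 j) (h1 k)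
      · intro t x y
        have h2 : ‖a t‖ ≤ ‖a‖ := lp.norm_apply_le_norm (by simp) a t
        calc ‖inner ℂ x (a t y)‖ ≤ ‖x‖ * ‖a t y‖ := norm_inner_le_norm _ _
          _ ≤ ‖x‖ * (‖a‖ * ‖y‖) := by gcongr; exact ((a t).le_opNorm y).trans (by gcongr)
          _ = ‖a‖ * ‖x‖ * ‖y‖ := by ring
      · intro t x x' y
        exact inner_sub_left _ _ _
      · intro t x y y'
        rw [map_sub, inner_sub_right]
      · intro ω hω ν hν
        exact (hw ν hν ω hω).continuousAt
    · filter_upwards [hU.mem_nhds htU] with t ht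
      obtain ⟨hli, hlt⟩ := h t ht
      refine lt_of_eq_of_lt (congrArg (fun x => ‖x - a t‖) ?_) hlt
      rw [spanProj_eq_sum hli]
      ext x
      simp only [Finset.sum_apply, _root_.sum_apply, _root_.smul_apply,
        ContinuousLinearMap.comp_apply, rankOne_apply, map_sum, map_smul, smul_smul,
        Finset.smul_sum]
      rw [Finset.sum_comm]
      refine Finset.sum_congr rfl fun j _ => Finset.sum_congr rfl fun k _ => ?_
      rw [mul_comm]
  · rintro ⟨ha, h0⟩
    refine ⟨fun ω hω ν hν => continuous_iff_continuousAt.2 fun t =>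
      hE.continuousAt_inner (le_approxAt E t hν) (hE.apply_mem (ha t) (le_approxAt E t hω)),
      fun t₀ ε hε => ?_, continuous_iff_continuousAt.2 fun t => hE.continuousAt_opNorm (ha t), h0⟩
    obtain ⟨n, e, m, he, ho, h⟩ := hE.exists_constant_coeff (ha t₀) (half_pos hε)
    have h2 := (hE.gramSchmidtNormed_mem (fun j => le_approxAt E t₀ (he j)) ho.linearIndependent).2
    obtain ⟨U, hU, hUo, htU⟩ := eventually_nhds_iff.1 (h.and h2)
    refine ⟨U, hUo, htU, n, e, he, fun t ht => ⟨(hU t ht).2, ?_⟩⟩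
    set p := spanProj fun j => e j t
    set F := ∑ p, m p • rankOne ℂ (e p.1 t) (e p.2 t) with hF
    have hp : ∀ j, p (e j t) = e j t := fun j =>
      spanProj_apply_of_mem (Submodule.subset_span ⟨j, rfl⟩)
    have hpF : p ∘L F ∘L p = F := by
      rw [hF]
      simp only [ContinuousLinearMap.finsetSum_comp, ContinuousLinearMap.comp_finsetSum,
        ContinuousLinearMap.smul_comp, ContinuousLinearMap.comp_smul, rankOne_comp, comp_rankOne,
        p, adjoint_spanProj]
      simp only [p] at hp
      simp only [hp]
    have hp1 : ‖p‖ ≤ 1 := norm_spanProj_le _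
    have e1 : p ∘L a t ∘L p - a t = (F - a t) - p ∘L (F - a t) ∘L p := by
      rw [ContinuousLinearMap.sub_comp, ContinuousLinearMap.comp_sub, hpF]
      abel
    have e2 : ‖p ∘L (F - a t) ∘L p‖ ≤ ‖F - a t‖ := by
      calc _ ≤ ‖p‖ * (‖F - a t‖ * ‖p‖) := (ContinuousLinearMap.opNorm_comp_le _ _).trans
            (by gcongr; exact ContinuousLinearMap.opNorm_comp_le _ _)
        _ ≤ 1 * (‖F - a t‖ * 1) := by gcongr
        _ = _ := by ring
    rw [e1]
    have := (hU t ht).1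
    linarith [norm_sub_le (F - a t) (p ∘L (F - a t) ∘L p)]

end ContinuousInner

end OperatorFields

/-! ### The Fell algebra is a closed ideal of itself -/

section FellAlgebra

variable {T : Type*} [TopologicalSpace T] {H : T → Type*} [∀ t, NormedAddCommGroup (H t)]
  [∀ t, InnerProductSpace ℂ (H t)] {E : Submodule ℂ (∀ t, H t)}

lemma mem_compactAt_of_mem_closure {S : Set (OpField H)} {t₀ : T}
    (hS : ∀ b ∈ S, (fun t => b t) ∈ compactAt E t₀) {a : OpField H} (ha : a ∈ closure S) :
    (fun t => a t) ∈ compactAt E t₀ := by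
  refine mem_approxAt_of_forall (G := fun t => H t →L[ℂ] H t) fun ε hε => ?_
  obtain ⟨b, hb, hab⟩ := Metric.mem_closure_iff.1 ha ε hε
  refine ⟨_, hS b hb, .of_forall fun t => ?_⟩
  rw [dist_comm, dist_eq_norm] at hab
  exact (lp.norm_apply_le_norm (by simp) (b - a) t).trans_lt hab

variable [∀ t, CompleteSpace (H t)]

/-- The Fell algebra as a subspace of the space of all bounded operator fields. -/
def fellSubmodule (hE : ContinuousInner E) : Submodule ℂ (OpField H) where
  carrier := fellAlgebra E
  zero_mem' := hE.mem_fellAlgebra_iff.2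
    ⟨fun t => zero_mem (compactAt E t), by simp [tendsto_const_nhds]⟩
  add_mem' := by
    intro a b ha hb
    rw [hE.mem_fellAlgebra_iff] at ha hb ⊢
    refine ⟨fun t => add_mem (ha.1 t) (hb.1 t), squeeze_zero (fun _ => norm_nonneg _)
      (fun t => norm_add_le _ _) ?_⟩
    simpa using ha.2.add hb.2
  smul_mem' := by
    intro c a ha
    rw [hE.mem_fellAlgebra_iff] at ha ⊢
    refine ⟨fun t => (compactAt E t).smul_mem c (ha.1 t), squeeze_zero (fun _ => norm_nonneg _)
      (fun t => norm_smul_le c (a t)) ?_⟩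
    simpa using ha.2.const_mul ‖c‖

lemma isClosed_fellAlgebra (hE : ContinuousInner E) : IsClosed (fellAlgebra E) := by
  refine isClosed_of_closure_subset fun a ha => hE.mem_fellAlgebra_iff.2
    ⟨fun t => mem_compactAt_of_mem_closure (fun b hb => (hE.mem_fellAlgebra_iff.1 hb).1 t) ha, ?_⟩
  rw [Metric.tendsto_nhds]
  intro ε hε
  obtain ⟨b, hb, hab⟩ := Metric.mem_closure_iff.1 ha (ε / 2) (half_pos hε)
  filter_upwards [Metric.tendsto_nhds.1 (hE.mem_fellAlgebra_iff.1 hb).2 (ε / 2) (half_pos hε)]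
    with t ht
  rw [dist_zero_right, norm_norm] at ht ⊢
  rw [dist_eq_norm] at hab
  have h1 : ‖a t - b t‖ ≤ ‖a - b‖ := lp.norm_apply_le_norm (by simp) (a - b) t
  linarith [norm_le_norm_sub_add (a t) (b t)]

lemma mul_mem_fellAlgebra (hE : ContinuousInner E) {a b : OpField H} (ha : a ∈ fellAlgebra E)
    (hb : b ∈ fellAlgebra E) : a * b ∈ fellAlgebra E := by
  rw [hE.mem_fellAlgebra_iff] at ha hb ⊢
  refine ⟨fun t => hE.comp_mem (ha.1 t) (hb.1 t), squeeze_zero (fun _ => norm_nonneg _)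
    (fun t => norm_mul_le (a t) (b t)) ?_⟩
  simpa using ha.2.mul hb.2

/-- The Fell algebra of a continuous Hilbert bundle is an essential ideal of itself. -/
instance (B : ContinuousHilbertBundle T H) : Nonempty B.EssIdeal := by
  have hE : ContinuousInner B.Ω := fun _ hω _ hν => B.continuous_inner_fields hω hν
  refine ⟨⟨fellSubmodule hE, ⟨subset_rfl, isClosed_fellAlgebra hE, fun a ha b hb =>
    ⟨mul_mem_fellAlgebra hE ha hb, mul_mem_fellAlgebra hE hb ha⟩⟩, fun J hJ hJ0 => ?_⟩⟩
  rwa [inf_eq_right.2 (show J ≤ fellSubmodule hE from hJ.1)]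

end FellAlgebra

/-! ### Adjointable operators as operator fields -/

section Adjointable

open InnerProductSpace

variable {T : Type*} {H : T → Type*} [∀ t, NormedAddCommGroup (H t)]
  [∀ t, InnerProductSpace ℂ (H t)] {Ω : Submodule ℂ (∀ t, H t)}

/-- Evaluation of bounded vector fields at a point. -/
def evalAt (Ω : Submodule ℂ (∀ t, H t)) (t : T) : boundedFields Ω →ₗ[ℂ] H t where
  toFun ξ := ξ.1 t
  map_add' _ _ := rfl
  map_smul' _ _ := rfl

/-- An adjointable operator commutes with multiplication by functions. -/
lemma adjointable_apply_smul (hd : ∀ t, DenseRange (evalAt Ω t)) (k : adjointable (boundedFields Ω))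
    {ξ η : boundedFields Ω} {g : T → ℂ} (h : ∀ t, η.1 t = g t • ξ.1 t) (t : T) :
    (k.1 η).1 t = g t • (k.1 ξ).1 t := by
  refine (hd t).eq_of_inner_left (𝕜 := ℂ) ?_
  intro ζ
  change inner ℂ _ (ζ.1 t) = inner ℂ _ (ζ.1 t)
  rw [star_adjointable_spec, inner_smul_left, star_adjointable_spec, h, inner_smul_left]

variable [TopologicalSpace T]

/-- The vector fields in `Ω` have continuous inner products, are stable under local uniform
limits, and take a dense set of values at every point. -/
structure IsHilbertBundle (Ω : Submodule ℂ (∀ t, H t)) : Prop where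
  continuousInner : ContinuousInner Ω
  mem_of_approx : ∀ f : ∀ t, H t, (∀ t, f ∈ approxAt Ω t) → f ∈ Ω
  dense : ∀ t, DenseRange (evalAt Ω t)

namespace IsHilbertBundle

lemma smul_mem (hΩ : IsHilbertBundle Ω) {g : T → ℂ} (hg : Continuous g) {ω : ∀ t, H t}
    (hω : ω ∈ Ω) : (fun t => g t • ω t) ∈ Ω :=
  hΩ.mem_of_approx _ fun t => hΩ.continuousInner.locallyBounded.smul_mem hg.continuousAt
    (le_approxAt Ω t hω)

lemma smul_mem_rankOneFields (hΩ : IsHilbertBundle Ω) {g : T → ℂ}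
    (hg : Continuous g) {F : ∀ t, H t →L[ℂ] H t} (hF : F ∈ rankOneFields Ω) :
    (fun t => g t • F t) ∈ rankOneFields Ω := by
  induction hF using Submodule.span_induction with
  | mem F hF =>
    obtain ⟨ω, hω, ν, hν, rfl⟩ := hF
    rw [show (fun t => g t • rankOne ℂ (ω t) (ν t)) = fun t => rankOne ℂ (g t • ω t) (ν t) from
      funext fun t => by rw [map_smul, _root_.smul_apply]]
    exact rankOne_mem_rankOneFields (hΩ.smul_mem hg hω) hν
  | zero =>
    rw [show (fun t => g t • (0 : ∀ t, H t →L[ℂ] H t) t) = 0 from funext fun t => smul_zero _]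
    exact zero_mem _
  | add F F' _ _ h h' =>
    rw [show (fun t => g t • (F + F') t) = (fun t => g t • F t) + fun t => g t • F' t from
      funext fun t => smul_add _ _ _]
    exact add_mem h h'
  | smul c F _ h =>
    rw [show (fun t => g t • (c • F) t) = c • fun t => g t • F t from
      funext fun t => by rw [Pi.smul_apply, Pi.smul_apply, smul_comm]]
    exact (rankOneFields Ω).smul_mem c h

/-- Adjointable operators are bounded fibrewise: `k` is applied to the field `ξ / max δ ‖ξ‖`, whose
norm is at most `1`. -/
lemma norm_apply_le (hΩ : IsHilbertBundle Ω) (k : adjointable (boundedFields Ω))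
    (ξ : boundedFields Ω) (t : T) : ‖(k.1 ξ).1 t‖ ≤ ‖k‖ * ‖ξ.1 t‖ := by
  refine le_of_forall_pos_le_add fun ε hε => ?_
  set δ := ε / (‖k‖ + 1)
  have hk : 0 < ‖k‖ + 1 := by positivity
  have hδ : 0 < δ := div_pos hε hk
  have hm : ∀ t, 0 < max δ ‖ξ.1 t‖ := fun t => lt_max_of_lt_left hδ
  let g : T → ℂ := fun t => ((max δ ‖ξ.1 t‖)⁻¹ : ℝ)
  have hg : Continuous g := Complex.continuous_ofReal.comp
    ((continuous_const.max (hΩ.continuousInner.continuous_norm ξ.2)).inv₀ fun t => (hm t).ne')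
  have hgn : ∀ t, ‖g t‖ = (max δ ‖ξ.1 t‖)⁻¹ := fun t => by
    rw [Complex.norm_real, Real.norm_of_nonneg (inv_nonneg.2 (hm t).le)]
  have hb : ∀ t, ‖g t • ξ.1 t‖ ≤ 1 := fun t => by
    rw [norm_smul, hgn, inv_mul_le_iff₀ (hm t), mul_one]
    exact le_max_right _ _
  let η : boundedFields Ω := ⟨⟨fun t => g t • ξ.1 t, memℓp_infty ⟨1, by rintro _ ⟨t, rfl⟩; exact hb t⟩⟩,
    hΩ.smul_mem hg ξ.2⟩
  have hη : ‖η‖ ≤ 1 := lp.norm_le_of_forall_le zero_le_one hb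
  have h0 : ‖k.1 η‖ ≤ ‖k‖ * ‖η‖ := k.1.le_opNorm η
  have h1 : ‖(k.1 η).1 t‖ ≤ ‖k‖ :=
    (lp.norm_apply_le_norm (by simp) (k.1 η).1 t).trans (h0.trans
      (mul_le_of_le_one_right (norm_nonneg k) hη))
  rw [adjointable_apply_smul hΩ.dense k (g := g) (fun _ => rfl), norm_smul, hgn,
    inv_mul_le_iff₀ (hm t)] at h1
  have h2 : max δ ‖ξ.1 t‖ ≤ δ + ‖ξ.1 t‖ :=
    max_le (le_add_of_nonneg_right (norm_nonneg _)) (le_add_of_nonneg_left hδ.le)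
  have h3 : δ * ‖k‖ ≤ ε := by
    rw [div_mul_eq_mul_div, div_le_iff₀ hk]
    nlinarith [norm_nonneg k]
  nlinarith [norm_nonneg k, mul_le_mul_of_nonneg_right h2 (norm_nonneg k)]

lemma opField_ext (hΩ : IsHilbertBundle Ω) {a b : OpField H}
    (h : ∀ (ξ : boundedFields Ω) t, a t (ξ.1 t) = b t (ξ.1 t)) : a = b := by
  refine lp.ext (funext fun t => ContinuousLinearMap.coeFn_injective ?_)
  exact (hΩ.dense t).equalizer (a t).continuous (b t).continuous (funext fun ξ => h ξ t)

variable [∀ t, CompleteSpace (H t)]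

/-- The operator field of an adjointable operator `k`; at `t` it extends `ξ(t) ↦ (k ξ)(t)` by
continuity. -/
def toOpField (hΩ : IsHilbertBundle Ω) (k : adjointable (boundedFields Ω)) : OpField H :=
  ⟨fun t => (evalAt Ω t ∘ₗ k.1.toLinearMap).extendOfNorm (evalAt Ω t), memℓp_infty ⟨‖k‖, by
    rintro _ ⟨t, rfl⟩
    exact LinearMap.opNorm_extendOfNorm_le (hΩ.dense t) (norm_nonneg _)
      fun ξ => hΩ.norm_apply_le k ξ t⟩⟩

lemma toOpField_apply (hΩ : IsHilbertBundle Ω) (k : adjointable (boundedFields Ω))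
    (ξ : boundedFields Ω) (t : T) : (k.1 ξ).1 t = hΩ.toOpField k t (ξ.1 t) :=
  (LinearMap.extendOfNorm_eq (f := evalAt Ω t ∘ₗ k.1.toLinearMap) (hΩ.dense t)
    ⟨‖k‖, fun ξ => hΩ.norm_apply_le k ξ t⟩ ξ).symm

/-- The identification of adjointable operators with operator fields that act pointwise. -/
def opFieldHom (hΩ : IsHilbertBundle Ω) : adjointable (boundedFields Ω) →⋆ₙₐ[ℂ] OpField H where
  toFun := hΩ.toOpField
  map_smul' c k := hΩ.opField_ext fun ξ t => by
    rw [← toOpField_apply]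
    change c • (k.1 ξ).1 t = c • hΩ.toOpField k t (ξ.1 t)
    rw [toOpField_apply]
  map_zero' := hΩ.opField_ext fun ξ t => by
    rw [← toOpField_apply]
    rfl
  map_add' k l := hΩ.opField_ext fun ξ t => by
    rw [← toOpField_apply]
    change (k.1 ξ).1 t + (l.1 ξ).1 t = hΩ.toOpField k t (ξ.1 t) + hΩ.toOpField l t (ξ.1 t)
    rw [toOpField_apply, toOpField_apply]
  map_mul' k l := hΩ.opField_ext fun ξ t => by
    rw [← toOpField_apply]
    change (k.1 (l.1 ξ)).1 t = hΩ.toOpField k t (hΩ.toOpField l t (ξ.1 t))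
    rw [toOpField_apply, toOpField_apply]
  map_star' k := hΩ.opField_ext fun ξ t => by
    rw [← toOpField_apply]
    change _ = ContinuousLinearMap.adjoint (hΩ.toOpField k t) (ξ.1 t)
    refine (hΩ.dense t).eq_of_inner_right (𝕜 := ℂ) ?_
    intro ζ
    rw [ContinuousLinearMap.adjoint_inner_right]
    change inner ℂ (ζ.1 t) _ = inner ℂ (hΩ.toOpField k t (ζ.1 t)) _
    rw [← toOpField_apply, star_adjointable_spec]

lemma isometry_opFieldHom (hΩ : IsHilbertBundle Ω) : Isometry hΩ.opFieldHom := by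
  refine AddMonoidHomClass.isometry_of_norm hΩ.opFieldHom fun k => le_antisymm ?_ ?_
  · refine lp.norm_le_of_forall_le (norm_nonneg _) fun t => ?_
    exact LinearMap.opNorm_extendOfNorm_le (hΩ.dense t) (norm_nonneg _)
      fun ξ => hΩ.norm_apply_le k ξ t
  · refine ContinuousLinearMap.opNorm_le_bound _ (norm_nonneg _) fun ξ => ?_
    refine lp.norm_le_of_forall_le (by positivity) fun t => ?_
    change ‖(k.1 ξ).1 t‖ ≤ _
    rw [toOpField_apply hΩ]
    refine (ContinuousLinearMap.le_opNorm _ _).trans ?_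
    gcongr
    · exact lp.norm_apply_le_norm (by simp) (hΩ.toOpField k) t
    · exact lp.norm_apply_le_norm (by simp) ξ.1 t

/-- A bounded operator field of locally finite rank acts on the module of bounded vector fields as
an adjointable operator. -/
lemma exists_opFieldHom_eq (hΩ : IsHilbertBundle Ω) {a : OpField H}
    (ha : ∀ t, (fun t => a t) ∈ compactAt Ω t) : ∃ k, hΩ.opFieldHom k = a := by
  let act (b : OpField H) (hb : ∀ t, (fun t => b t) ∈ compactAt Ω t) :
      boundedFields Ω →L[ℂ] boundedFields Ω :=
    LinearMap.mkContinuous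
      { toFun ξ := ⟨⟨fun t => b t (ξ.1 t), memℓp_infty ⟨‖b‖ * ‖ξ‖, by
          rintro _ ⟨t, rfl⟩
          refine ((b t).le_opNorm _).trans ?_
          gcongr
          · exact lp.norm_apply_le_norm (by simp) b t
          · exact lp.norm_apply_le_norm (by simp) ξ.1 t⟩⟩,
          hΩ.mem_of_approx _ fun t =>
            hΩ.continuousInner.apply_mem (hb t) (le_approxAt Ω t ξ.2)⟩
        map_add' ξ η := Subtype.ext (lp.ext (funext fun t => map_add (b t) _ _))
        map_smul' c ξ := Subtype.ext (lp.ext (funext fun t => map_smul (b t) _ _)) } ‖b‖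
      (fun ξ => lp.norm_le_of_forall_le (by positivity) fun t => by
        refine ((b t).le_opNorm _).trans ?_
        gcongr
        · exact lp.norm_apply_le_norm (by simp) b t
        · exact lp.norm_apply_le_norm (by simp) ξ.1 t)
  have hs : ∀ t, (fun t => (star a) t) ∈ compactAt Ω t := fun t =>
    ContinuousInner.adjoint_mem (ha t)
  refine ⟨⟨act a ha, act (star a) hs, fun ξ η t => ?_⟩, hΩ.opField_ext fun ξ t => ?_⟩
  · exact (ContinuousLinearMap.adjoint_inner_right (a t) (ξ.1 t) (η.1 t)).symm
  · exact (hΩ.toOpField_apply _ ξ t).symm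

/-- The operator fields of the finite rank operators are the operator fields of finite rank. -/
lemma image_finiteRank (hΩ : IsHilbertBundle Ω) (hb : ∀ ω ∈ Ω, Memℓp ω ∞) :
    hΩ.opFieldHom '' finiteRank (boundedFields Ω) = {a | (fun t => a t) ∈ rankOneFields Ω} := by
  ext a
  constructor
  · rintro ⟨k, ⟨n, ω, ν, hk⟩, rfl⟩
    have : (fun t => hΩ.opFieldHom k t) =
        ∑ i, fun t => rankOne ℂ ((ω i).1 t) ((ν i).1 t) := by
      funext t
      refine ContinuousLinearMap.coeFn_injective ((hΩ.dense t).equalizer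
        (ContinuousLinearMap.continuous _) (ContinuousLinearMap.continuous _) (funext fun ξ => ?_))
      refine (hΩ.toOpField_apply k ξ t).symm.trans ((hk ξ t).trans ?_)
      rw [Finset.sum_apply, Function.comp_apply, _root_.sum_apply]
      rfl
    change (fun t => hΩ.opFieldHom k t) ∈ rankOneFields Ω
    rw [this]
    exact sum_mem fun i _ => rankOne_mem_rankOneFields (ω i).2 (ν i).2
  · intro ha
    obtain ⟨k, rfl⟩ := hΩ.exists_opFieldHom_eq (a := a) fun t => le_approxAt _ t ha
    refine ⟨k, ?_, rfl⟩
    obtain ⟨n, c, r, hr⟩ := Submodule.mem_span_set'.1 ha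
    choose ω hω ν hν h using fun i => (r i).2
    refine ⟨n, fun i => ⟨⟨c i • ω i, hb _ (Ω.smul_mem _ (hω i))⟩, Ω.smul_mem _ (hω i)⟩,
      fun i => ⟨⟨ν i, hb _ (hν i)⟩, hν i⟩, fun ξ t => ?_⟩
    refine (hΩ.toOpField_apply k ξ t).trans ?_
    have h1 : hΩ.toOpField k t = ∑ i, c i • rankOne ℂ (ω i t) (ν i t) := by
      refine (congrFun hr t).symm.trans ?_
      rw [Finset.sum_apply]
      exact Finset.sum_congr rfl fun i _ => by rw [Pi.smul_apply, h i]
    rw [h1, _root_.sum_apply]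
    refine Finset.sum_congr rfl fun i _ => ?_
    exact smul_comm _ _ _

/-- The operator fields of the compact operators are the uniform limits of the operator fields of
finite rank. -/
lemma image_compactOps (hΩ : IsHilbertBundle Ω) (hb : ∀ ω ∈ Ω, Memℓp ω ∞) :
    hΩ.opFieldHom '' compactOps (boundedFields Ω) =
      closure {a | (fun t => a t) ∈ rankOneFields Ω} := by
  rw [← hΩ.image_finiteRank hb]
  refine (image_closure_subset_closure_image hΩ.isometry_opFieldHom.continuous).antisymm
    fun a ha => ?_
  -- The range need not be known to be closed: limits of finite rank fields are in it.
  obtain ⟨k, rfl⟩ := hΩ.exists_opFieldHom_eq (a := a) fun t => mem_compactAt_of_mem_closure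
    (fun b hb' => by
      rw [hΩ.image_finiteRank hb] at hb'
      exact le_approxAt _ t hb') ha
  refine ⟨k, ?_, rfl⟩
  change k ∈ closure (finiteRank (boundedFields Ω))
  rw [hΩ.isometry_opFieldHom.isUniformInducing.isInducing.closure_eq_preimage_closure_image]
  exact ha

end IsHilbertBundle

end Adjointable

/-! ### The direct limit bundle is a Hilbert bundle over a compact space -/

section Compact

variable {T : Type*} [TopologicalSpace T] {G : T → Type*} [∀ t, NormedAddCommGroup (G t)]

lemma memℓp_of_continuous_norm [CompactSpace T] {f : ∀ t, G t} (hf : Continuous fun t => ‖f t‖) :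
    Memℓp f ∞ :=
  memℓp_infty (isCompact_range hf).bddAbove

end Compact

namespace ContinuousHilbertBundle

open InnerProductSpace

variable {T : Type*} [TopologicalSpace T] {H : T → Type*} [∀ t, NormedAddCommGroup (H t)]
  [∀ t, InnerProductSpace ℂ (H t)] {B : ContinuousHilbertBundle T H}

instance : CompactSpace B.Delta := by
  have : IsClosed {s : ∀ I : B.EssIdeal, I.beta |
      ∀ (J I : B.EssIdeal) (h : J ≤ I), s J = EssIdeal.Phi h (s I)} := by
    simp only [Set.ofPred_forall]
    exact isClosed_iInter fun J => isClosed_iInter fun I => isClosed_iInter fun h =>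
      isClosed_eq (continuous_apply J) ((EssIdeal.continuous_Phi h).comp (continuous_apply I))
  exact isCompact_iff_compactSpace.1 this.isCompact

lemma Delta.continuous_proj (I : B.EssIdeal) : Continuous fun s : B.Delta => s.proj I :=
  (continuous_apply I).comp continuous_subtype_val

/-- The preimages of the open sets of the spaces `βX^I` form a basis of the topology of `Δ`. -/
lemma Delta.exists_proj_preimage_subset [Nonempty B.EssIdeal] {s : B.Delta} {N : Set B.Delta}
    (hN : N ∈ 𝓝 s) : ∃ (I : B.EssIdeal) (V : Set I.beta), IsOpen V ∧ s.proj I ∈ V ∧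
      ∀ s' : B.Delta, s'.proj I ∈ V → s' ∈ N := by
  have h1 : 𝓝 s = ⨅ I, comap (fun s : B.Delta => s.proj I) (𝓝 (s.proj I)) := by
    refine (nhds_subtype_eq_comap (p := fun s : ∀ I : B.EssIdeal, I.beta =>
      ∀ (J I : B.EssIdeal) (h : J ≤ I), s J = EssIdeal.Phi h (s I)) (h := s.2)).trans ?_
    rw [nhds_pi, Filter.pi, comap_iInf]
    simp only [comap_comap]
    rfl
  have h2 : Directed (· ≥ ·) fun I => comap (fun s : B.Delta => s.proj I) (𝓝 (s.proj I)) := by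
    have key : ∀ {J I : B.EssIdeal}, J ≤ I → comap (fun s : B.Delta => s.proj I) (𝓝 (s.proj I)) ≤
        comap (fun s : B.Delta => s.proj J) (𝓝 (s.proj J)) := fun {J I} h => by
      rw [show (fun s : B.Delta => s.proj J) = EssIdeal.Phi h ∘ fun s => s.proj I from
        funext fun s => s.proj_eq h, ← comap_comap, s.proj_eq h]
      exact comap_mono (EssIdeal.continuous_Phi h).continuousAt.le_comap
    exact fun I J => ⟨I ⊔ J, key le_sup_left, key le_sup_right⟩
  rw [h1, mem_iInf_of_directed h2] at hN
  obtain ⟨I, W, hW, hWN⟩ := hN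
  obtain ⟨V, hVW, hV, hs⟩ := mem_nhds_iff.1 hW
  exact ⟨I, V, hV, hs, fun s' hs' => hWN (hVW hs')⟩

lemma continuousInner_range_bar (I : B.EssIdeal) : ContinuousInner (LinearMap.range (bar I)) := by
  rintro _ ⟨ω, rfl⟩ _ ⟨ν, rfl⟩
  have : (fun t => inner ℂ (bar I ω t) (bar I ν t)) = fun t => PreFibre.form I t ω ν :=
    funext fun t => UniformSpace.Completion.inner_coe (𝕜 := ℂ) (E := PreFibre I t) ω ν
  rw [this]
  exact PreFibre.continuous_form ω ν

lemma range_bar_le_OmegaI (I : B.EssIdeal) : LinearMap.range (bar I) ≤ OmegaI I :=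
  fun _ h => mem_localUniformLimits_iff.2 fun t => le_approxAt _ t h

lemma OmegaI_le_approxAt (I : B.EssIdeal) (t : I.beta) :
    OmegaI I ≤ approxAt (LinearMap.range (bar I)) t :=
  fun _ h => mem_localUniformLimits_iff.1 h t

lemma continuousInner_OmegaI (I : B.EssIdeal) : ContinuousInner (OmegaI I) :=
  (continuousInner_range_bar I).of_le (OmegaI_le_approxAt I)

lemma toLimit_bar_eq (I J : B.EssIdeal) (s : B.Delta) (ω : boundedFields B.Ω) :
    toLimit I s (bar I ω (s.proj I)) = toLimit J s (bar J ω (s.proj J)) := by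
  have key : ∀ {I J : B.EssIdeal}, I ≤ J →
      toLimit I s (bar I ω (s.proj I)) = toLimit J s (bar J ω (s.proj J)) := fun {I J} h => by
    rw [← connect_bar s I J h]
    exact ((system s).of_map I J h _).symm
  rw [key (le_sup_left : I ≤ I ⊔ J), key (le_sup_right : J ≤ I ⊔ J)]

/-- The vector field on `Δ` induced by a bounded vector field `ω`, through the stage `I`. -/
def deltaField (I : B.EssIdeal) : boundedFields B.Ω →ₗ[ℂ] ∀ s : B.Delta, DeltaFibre s :=
  pullField I ∘ₗ bar I

/-- The fields induced by bounded vector fields do not depend on the stage. -/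
lemma deltaField_eq (I J : B.EssIdeal) : deltaField I = deltaField J :=
  LinearMap.ext fun ω => funext fun s => toLimit_bar_eq I J s ω

lemma continuousInner_range_deltaField (I : B.EssIdeal) :
    ContinuousInner (LinearMap.range (deltaField I)) := by
  rintro _ ⟨ω, rfl⟩ _ ⟨ν, rfl⟩
  have : (fun s => inner ℂ (deltaField I ω s) (deltaField I ν s)) =
      (fun t => inner ℂ (bar I ω t) (bar I ν t)) ∘ fun s : B.Delta => s.proj I :=
    funext fun s => (toLimit I s).inner_map_map _ _
  rw [this]
  exact (continuousInner_range_bar I _ ⟨ω, rfl⟩ _ ⟨ν, rfl⟩).comp (Delta.continuous_proj I)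

lemma algLimit_le_approxAt (I : B.EssIdeal) (s : B.Delta) :
    B.algLimit ≤ approxAt (LinearMap.range (deltaField I)) s := by
  refine iSup_le fun J => ?_
  rw [deltaField_eq I J]
  rintro _ ⟨ν, hν, rfl⟩ ε hε
  obtain ⟨_, ⟨ω, rfl⟩, h⟩ := OmegaI_le_approxAt J (s.proj J) hν ε hε
  refine ⟨_, ⟨ω, rfl⟩, ?_⟩
  filter_upwards [(Delta.continuous_proj J).continuousAt.eventually h] with s' hs'
  have : deltaField J ω s' - pullField J ν s' =
      toLimit J s' (bar J ω (s'.proj J) - ν (s'.proj J)) := (map_sub (toLimit J s') _ _).symm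
  rwa [this, LinearIsometryEquiv.norm_map]

lemma mem_OmegaDelta_iff (I : B.EssIdeal) {ξ : ∀ s : B.Delta, DeltaFibre s} :
    ξ ∈ B.OmegaDelta ↔ ∀ s, ξ ∈ approxAt (LinearMap.range (deltaField I)) s := by
  constructor
  · exact fun h s => approxAt_le (algLimit_le_approxAt I s) (mem_localUniformLimits_iff.1 h.2 s)
  · refine fun h => ⟨memℓp_of_continuous_norm (continuous_iff_continuousAt.2 fun s =>
      (continuousInner_range_deltaField I).continuousAt_norm (h s)),
      mem_localUniformLimits_iff.2 fun s => approxAt_le (fun _ he => le_approxAt _ s ?_) (h s)⟩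
    obtain ⟨ω, rfl⟩ := he
    exact le_iSup (fun I : B.EssIdeal => (OmegaI I).map (pullField I)) I
      ⟨_, range_bar_le_OmegaI I ⟨ω, rfl⟩, rfl⟩

lemma range_deltaField_le (I : B.EssIdeal) : LinearMap.range (deltaField I) ≤ B.OmegaDelta :=
  fun _ h => (mem_OmegaDelta_iff I).2 fun s => le_approxAt _ s h

lemma OmegaDelta_le_approxAt (I : B.EssIdeal) (s : B.Delta) :
    B.OmegaDelta ≤ approxAt (LinearMap.range (deltaField I)) s :=
  fun _ h => (mem_OmegaDelta_iff I).1 h s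

lemma isHilbertBundle_OmegaDelta [Nonempty B.EssIdeal] : IsHilbertBundle B.OmegaDelta := by
  let I := Classical.arbitrary B.EssIdeal
  refine ⟨(continuousInner_range_deltaField I).of_le (OmegaDelta_le_approxAt I), fun f hf =>
    (mem_OmegaDelta_iff I).2 fun s => approxAt_le (OmegaDelta_le_approxAt I s) (hf s), fun s => ?_⟩
  have h1 : DenseRange fun ω : boundedFields B.Ω => toLimit I s (bar I ω (s.proj I)) :=
    (toLimit I s).surjective.denseRange.comp
      (UniformSpace.Completion.denseRange_coe (α := PreFibre I (s.proj I)))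
      (toLimit I s).continuous
  refine h1.mono ?_
  rintro _ ⟨ω, rfl⟩
  have h2 := range_deltaField_le I ⟨ω, rfl⟩
  exact ⟨⟨⟨deltaField I ω, h2.1⟩, h2⟩, rfl⟩

/-! ### Transport of operator fields to the direct limit -/

/-- The operator `Ψ_{I,s} a Ψ_{I,s}⁻¹` on the fibre of the direct limit bundle. -/
def conjOp (I : B.EssIdeal) (s : B.Delta) :
    (Fibre I (s.proj I) →L[ℂ] Fibre I (s.proj I)) →ₗ[ℂ] (DeltaFibre s →L[ℂ] DeltaFibre s) where
  toFun a := ((toLimit I s : Fibre I (s.proj I) →L[ℂ] DeltaFibre s) ∘L a) ∘L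
      ((toLimit I s).symm : DeltaFibre s →L[ℂ] Fibre I (s.proj I))
  map_add' a b := by rw [ContinuousLinearMap.comp_add, ContinuousLinearMap.add_comp]
  map_smul' c a := by
    rw [ContinuousLinearMap.comp_smul, ContinuousLinearMap.smul_comp, RingHom.id_apply]

lemma pullOp_apply (I : B.EssIdeal) (a : OpField (fun t : I.beta => Fibre I t)) (s : B.Delta) :
    pullOp I a s = conjOp I s (a (s.proj I)) := rfl

lemma norm_conjOp_le (I : B.EssIdeal) (s : B.Delta)
    (a : Fibre I (s.proj I) →L[ℂ] Fibre I (s.proj I)) : ‖conjOp I s a‖ ≤ ‖a‖ := by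
  refine ContinuousLinearMap.opNorm_le_bound _ (norm_nonneg _) fun x => ?_
  change ‖toLimit I s (a ((toLimit I s).symm x))‖ ≤ _
  rw [LinearIsometryEquiv.norm_map, ← (toLimit I s).symm.norm_map x]
  exact a.le_opNorm _

lemma conjOp_rankOne (I : B.EssIdeal) (s : B.Delta) (x y : Fibre I (s.proj I)) :
    conjOp I s (rankOne ℂ x y) = rankOne ℂ (toLimit I s x) (toLimit I s y) := by
  ext z
  change toLimit I s (inner ℂ y ((toLimit I s).symm z) • x) = inner ℂ (toLimit I s y) z • _
  rw [map_smul, ← (toLimit I s).inner_map_map, LinearIsometryEquiv.apply_symm_apply]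

/-- The fields of finite rank on `Δ` that are built from the fields `ω ∘ Φ_I` are exactly the
transports of those on `βX^I`. -/
lemma mem_rankOneFields_deltaField_iff (I : B.EssIdeal)
    {F : ∀ s : B.Delta, DeltaFibre s →L[ℂ] DeltaFibre s} :
    F ∈ rankOneFields (LinearMap.range (deltaField I)) ↔
      ∃ G ∈ rankOneFields (LinearMap.range (bar I)), F = fun s => conjOp I s (G (s.proj I)) := by
  constructor
  · intro hF
    induction hF using Submodule.span_induction with
    | mem F hF =>
      obtain ⟨_, ⟨ω, rfl⟩, _, ⟨ν, rfl⟩, rfl⟩ := hF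
      exact ⟨_, rankOne_mem_rankOneFields ⟨ω, rfl⟩ ⟨ν, rfl⟩,
        funext fun s => (conjOp_rankOne I s _ _).symm⟩
    | zero => exact ⟨0, zero_mem _, funext fun s => (map_zero (conjOp I s)).symm⟩
    | add F F' _ _ h h' =>
      obtain ⟨G, hG, rfl⟩ := h
      obtain ⟨G', hG', rfl⟩ := h'
      exact ⟨G + G', add_mem hG hG', funext fun s => (map_add (conjOp I s) _ _).symm⟩
    | smul c F _ h =>
      obtain ⟨G, hG, rfl⟩ := h
      exact ⟨c • G, (rankOneFields _).smul_mem c hG,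
        funext fun s => (map_smul (conjOp I s) _ _).symm⟩
  · rintro ⟨G, hG, rfl⟩
    induction hG using Submodule.span_induction with
    | mem F hF =>
      obtain ⟨_, ⟨ω, rfl⟩, _, ⟨ν, rfl⟩, rfl⟩ := hF
      rw [show (fun s : B.Delta => conjOp I s (rankOne ℂ (bar I ω (s.proj I))
        (bar I ν (s.proj I)))) = fun s => rankOne ℂ (deltaField I ω s) (deltaField I ν s) from
        funext fun s => conjOp_rankOne I s _ _]
      exact rankOne_mem_rankOneFields ⟨ω, rfl⟩ ⟨ν, rfl⟩
    | zero =>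
      rw [show (fun s : B.Delta => conjOp I s ((0 : ∀ t : I.beta, Fibre I t →L[ℂ] Fibre I t)
        (s.proj I))) = 0 from funext fun s => map_zero (conjOp I s)]
      exact zero_mem _
    | add F F' _ _ h h' =>
      rw [show (fun s : B.Delta => conjOp I s ((F + F') (s.proj I))) =
        (fun s => conjOp I s (F (s.proj I))) + fun s => conjOp I s (F' (s.proj I)) from
        funext fun s => map_add (conjOp I s) _ _]
      exact add_mem h h'
    | smul c F _ h =>
      rw [show (fun s : B.Delta => conjOp I s ((c • F) (s.proj I))) =
        c • (fun s => conjOp I s (F (s.proj I))) from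
        funext fun s => map_smul (conjOp I s) _ _]
      exact (rankOneFields _).smul_mem c h

/-! ### Approximation by operator fields from a single stage -/

lemma pullOp_mem_compactAt (I : B.EssIdeal) {a : OpField (fun t : I.beta => Fibre I t)}
    (ha : a ∈ fellAlgebra (OmegaI I)) (s : B.Delta) :
    (fun s => pullOp I a s) ∈ compactAt B.OmegaDelta s := by
  have h1 := (continuousInner_range_bar I).compactAt_le (OmegaI_le_approxAt I (s.proj I))
    (((continuousInner_OmegaI I).mem_fellAlgebra_iff.1 ha).1 (s.proj I))
  intro ε hε
  obtain ⟨G, hG, h⟩ := h1 ε hε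
  refine ⟨_, rankOneFields_mono (range_deltaField_le I)
    ((mem_rankOneFields_deltaField_iff I).2 ⟨G, hG, rfl⟩), ?_⟩
  filter_upwards [(Delta.continuous_proj I).continuousAt.eventually h] with s hs
  rw [pullOp_apply, ← map_sub]
  exact (norm_conjOp_le I s _).trans_lt hs

/-- An operator field on `Δ` that is locally of almost finite rank is uniformly close to the
transport of an element of some `A^I` that has finite rank. The local approximations are patched
by a partition of unity on `βX^I`, where `I` is a stage at which all sets of a finite cover
appear. -/
lemma exists_pullOp_close [Nonempty B.EssIdeal]
    {a : OpField (fun s : B.Delta => DeltaFibre s)}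
    (ha : ∀ s, (fun s => a s) ∈ compactAt B.OmegaDelta s) {ε : ℝ} (hε : 0 < ε) :
    ∃ (I : B.EssIdeal) (b : OpField (fun t : I.beta => Fibre I t)), b ∈ fellAlgebra (OmegaI I) ∧
      (fun s => pullOp I b s) ∈ rankOneFields B.OmegaDelta ∧ ‖a - pullOp I b‖ ≤ ε := by
  classical
  let I₀ := Classical.arbitrary B.EssIdeal
  have hloc : ∀ s : B.Delta, ∃ (F : ∀ s : B.Delta, DeltaFibre s →L[ℂ] DeltaFibre s)
      (I : B.EssIdeal) (V : Set I.beta), F ∈ rankOneFields (LinearMap.range (deltaField I₀)) ∧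
      IsOpen V ∧ s.proj I ∈ V ∧ ∀ s' : B.Delta, s'.proj I ∈ V → ‖F s' - a s'‖ < ε := by
    intro s
    obtain ⟨F, hF, h⟩ := (continuousInner_range_deltaField I₀).compactAt_le
      (OmegaDelta_le_approxAt I₀ s) (ha s) ε hε
    obtain ⟨I, V, hV, hs, hV'⟩ := Delta.exists_proj_preimage_subset h
    exact ⟨F, I, V, hF, hV, hs, hV'⟩
  choose F J V hF hV hsV hFa using hloc
  obtain ⟨S, hS⟩ := isCompact_univ.elim_finite_subcover
    (fun s : B.Delta => {s' : B.Delta | s'.proj (J s) ∈ V s})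
    (fun s => (hV s).preimage (Delta.continuous_proj (J s)))
    (fun s _ => Set.mem_iUnion.2 ⟨s, hsV s⟩)
  obtain ⟨I, hI⟩ := Finset.exists_le (S.image J)
  have hJI : ∀ i : S, J i ≤ I := fun i => hI _ (Finset.mem_image_of_mem J i.2)
  choose G hG hFG using fun i : S => (mem_rankOneFields_deltaField_iff I).1
    (deltaField_eq I₀ I ▸ hF i)
  have hK : IsClosed (Set.range fun s : B.Delta => s.proj I) :=
    (isCompact_range (Delta.continuous_proj I)).isClosed
  obtain ⟨φ, hφ⟩ := PartitionOfUnity.exists_isSubordinate hK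
    (fun i : S => EssIdeal.Phi (hJI i) ⁻¹' V i)
    (fun i => (hV i).preimage (EssIdeal.continuous_Phi _)) (by
      rintro _ ⟨s, rfl⟩
      obtain ⟨i, hi⟩ := Set.mem_iUnion.1 (hS (Set.mem_univ s))
      obtain ⟨hiS, hi⟩ := Set.mem_iUnion.1 hi
      refine Set.mem_iUnion.2 ⟨⟨i, hiS⟩, ?_⟩
      change EssIdeal.Phi (hJI ⟨i, hiS⟩) (s.proj I) ∈ V i
      rw [← s.proj_eq]
      exact hi)
  have hφc : ∀ i, Continuous fun t => (φ i t : ℂ) := fun i =>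
    Complex.continuous_ofReal.comp (φ i).continuous
  have hE := continuousInner_OmegaI I
  let b₀ : ∀ t : I.beta, Fibre I t →L[ℂ] Fibre I t := ∑ i, fun t => (φ i t : ℂ) • G i t
  have hb₀ : ∀ t, b₀ ∈ compactAt (OmegaI I) t := fun t => sum_mem fun i _ =>
    hE.rankOneFields_locallyBounded.smul_mem (hφc i).continuousAt
      (le_approxAt _ t (rankOneFields_mono (range_bar_le_OmegaI I) (hG i)))
  let b : OpField (fun t : I.beta => Fibre I t) := ⟨b₀, memℓp_of_continuous_norm
    (continuous_iff_continuousAt.2 fun t => hE.continuousAt_opNorm (hb₀ t))⟩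
  have hb : ∀ s, pullOp I b s = ∑ i : S, (φ i (s.proj I) : ℂ) • F i s := fun s => by
    rw [pullOp_apply]
    change conjOp I s (b₀ (s.proj I)) = _
    simp only [b₀, Finset.sum_apply, map_sum, map_smul]
    exact Finset.sum_congr rfl fun i _ => by rw [hFG i]
  refine ⟨I, b, hE.mem_fellAlgebra_iff.2 ⟨hb₀, by simp⟩, ?_,
    lp.norm_le_of_forall_le hε.le fun s => ?_⟩
  · rw [show (fun s => pullOp I b s) = ∑ i : S, fun s => (φ i (s.proj I) : ℂ) • F i s from
      funext fun s => by rw [hb, Finset.sum_apply]]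
    exact sum_mem fun i _ => isHilbertBundle_OmegaDelta.smul_mem_rankOneFields
      ((hφc i).comp (Delta.continuous_proj I))
      (rankOneFields_mono (range_deltaField_le I₀) (hF i))
  · have hsum : ∑ i : S, φ i (s.proj I) = 1 := by
      rw [← finsum_eq_sum_of_fintype]
      exact φ.sum_eq_one ⟨s, rfl⟩
    have e1 : (a - pullOp I b) s = ∑ i : S, (φ i (s.proj I) : ℂ) • (a s - F i s) := by
      change a s - pullOp I b s = _
      rw [hb]
      simp only [smul_sub, Finset.sum_sub_distrib]
      rw [← Finset.sum_smul, ← Complex.ofReal_sum, hsum, Complex.ofReal_one, one_smul]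
    rw [e1]
    calc _ ≤ ∑ i : S, φ i (s.proj I) * ε := by
          refine (norm_sum_le _ _).trans (Finset.sum_le_sum fun i _ => ?_)
          rw [norm_smul, Complex.norm_real, Real.norm_of_nonneg (φ.nonneg i _)]
          by_cases h0 : φ i (s.proj I) = 0
          · rw [h0, zero_mul, zero_mul]
          refine mul_le_mul_of_nonneg_left ?_ (φ.nonneg i _)
          have h1 : EssIdeal.Phi (hJI i) (s.proj I) ∈ V i := hφ i (subset_tsupport _ h0)
          rw [← s.proj_eq] at h1
          rw [norm_sub_rev]
          exact (hFa i s h1).le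
      _ = ε := by rw [← Finset.sum_mul, hsum, one_mul]

variable [Nonempty B.EssIdeal]

lemma mem_upperA_iff {a : OpField (fun s : B.Delta => DeltaFibre s)} :
    a ∈ B.upperA ↔ ∀ s, (fun s => a s) ∈ compactAt B.OmegaDelta s := by
  rw [upperA, isHilbertBundle_OmegaDelta.continuousInner.mem_fellAlgebra_iff]
  simp

lemma lowerA_eq_upperA : B.lowerA = B.upperA := by
  refine Set.Subset.antisymm (fun a ha => mem_upperA_iff.2 fun s =>
    mem_compactAt_of_mem_closure ?_ ha) fun a ha => Metric.mem_closure_iff.2 fun ε hε => ?_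
  · intro b hb
    obtain ⟨I, c, hc, rfl⟩ := Set.mem_iUnion.1 hb
    exact pullOp_mem_compactAt I hc s
  · obtain ⟨I, b, hb, -, hab⟩ := exists_pullOp_close (mem_upperA_iff.1 ha) (half_pos hε)
    refine ⟨_, Set.mem_iUnion.2 ⟨I, b, hb, rfl⟩, ?_⟩
    rw [dist_eq_norm]
    linarith

lemma closure_rankOneFields_eq_upperA :
    closure {a : OpField (fun s : B.Delta => DeltaFibre s) |
      (fun s => a s) ∈ rankOneFields B.OmegaDelta} = B.upperA := by
  refine Set.Subset.antisymm (fun a ha => mem_upperA_iff.2 fun s =>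
    mem_compactAt_of_mem_closure (fun b hb => le_approxAt _ s hb) ha)
    fun a ha => Metric.mem_closure_iff.2 fun ε hε => ?_
  obtain ⟨I, b, -, hb, hab⟩ := exists_pullOp_close (mem_upperA_iff.1 ha) (half_pos hε)
  refine ⟨_, hb, ?_⟩
  rw [dist_eq_norm]
  linarith

end ContinuousHilbertBundle

end

theorem proposition4p2 {T : Type*} [TopologicalSpace T] [LocallyCompactSpace T] [T2Space T]
    {H : T → Type*} [∀ t, NormedAddCommGroup (H t)] [∀ t, InnerProductSpace ℂ (H t)]
    [∀ t, CompleteSpace (H t)] (B : ContinuousHilbertBundle T H) :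
    (∃ Γ : adjointable (boundedFields B.OmegaDelta) →⋆ₙₐ[ℂ]
          OpField (fun s : B.Delta => ContinuousHilbertBundle.DeltaFibre s),
        Isometry Γ ∧
        (∀ (k : adjointable (boundedFields B.OmegaDelta)) (ξ : boundedFields B.OmegaDelta)
          (s : B.Delta), (k.1 ξ).1 s = Γ k s (ξ.1 s)) ∧
        Γ '' compactOps (boundedFields B.OmegaDelta) = B.lowerA) ∧
      B.lowerA = B.upperA := by
  have hΩ : IsHilbertBundle B.OmegaDelta := ContinuousHilbertBundle.isHilbertBundle_OmegaDelta
  refine ⟨⟨hΩ.opFieldHom, hΩ.isometry_opFieldHom, hΩ.toOpField_apply, ?_⟩,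
    ContinuousHilbertBundle.lowerA_eq_upperA⟩
  rw [hΩ.image_compactOps fun ω hω => hω.1,
    ContinuousHilbertBundle.closure_rankOneFields_eq_upperA,
    ContinuousHilbertBundle.lowerA_eq_upperA]
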